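/- Let $\mathbf H=-\Delta+|x|^2$ on $\mathbb R^2$ and let $e_k(x)=\pi^{-1/2}\mathcal L_k^0(|x|^2)$, $k\ge 0$, where $\mathcal L_k^0(z)=\frac{e^{z/2}}{k!}\frac{d^k}{dz^k}(z^ke^{-z})$; these are the normalized radial eigenfunctions of $\mathbf H$, with $\mathbf H e_k=(4k+2)e_k$. For a radial tempered distribution $u$ and $s\in\mathbb R$ put $\mathbf H^s u=\sum_{k\ge0}(4k+2)^s\langle u,e_k\rangle e_k$ (convergence in $\mathcal S'(\mathbb R^2)$). Let $(g_k)_{k\ge0}$ be independent normalized complex Gaussian random variables (density $\frac1\pi e^{-|z|^2}$ on $\mathbb C$) on a probability space $(\Omega,\Sigma,\mathbb P)$, and let $$f(\omega)=\sum_{k=0}^\infty\frac{1}{\sqrt{4k+2}}\,g_k(\omega)\,e_k .$$ Let $\sigma\ge\frac12$. Then, almost surely, the series defining $f(\omega)$ and $\mathbf H^{\sigma/2}f(\omega)$ converge (unconditionally) in $\mathcal S'(\mathbb R^2)$, the distribution $\mathbf H^{\sigma/2}f(\omega)$ is not a locally integrable function, and more precisely $$\psi\cdot\mathbf H^{\sigma/2}f(\omega)\notin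 L^1(\mathbb R^2)\quad\text{for all smooth compactly supported }\psi:\mathbb R^2\to\mathbb C\text{ that are not identically zero}$$ (the exceptional null set does not depend on $\psi$). -/

import Mathlib

open MeasureTheory ProbabilityTheory SchwartzMap
open scoped ContDiff Laplacian LineDeriv

noncomputable section

/-! ### Laguerre functions and the radial eigenfunctions of the Hermite operator -/

/-- The Euclidean plane `ℝ²`. -/
abbrev Plane : Type := EuclideanSpace ℝ (Fin 2)

/-- The Laguerre function `ℒ_k⁰(z) = e^{z/2} / k! · (d/dz)^k (z^k e^{-z})`. -/
def laguerreFun (k : ℕ) (z : ℝ) : ℝ :=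
  Real.exp (z / 2) / (k.factorial : ℝ) * iteratedDeriv k (fun t : ℝ => t ^ k * Real.exp (-t)) z

theorem iteratedDeriv_poly_mul_exp_neg (n : ℕ) (p : Polynomial ℝ) :
    ∃ q : Polynomial ℝ, iteratedDeriv n (fun t : ℝ => p.eval t * Real.exp (-t)) =
      fun t : ℝ => q.eval t * Real.exp (-t) := by
  induction n generalizing p with
  | zero => exact ⟨p, by simp⟩
  | succ n ih =>
    obtain ⟨q, hq⟩ := ih (Polynomial.derivative p - p)
    refine ⟨q, ?_⟩
    rw [iteratedDeriv_succ', ← hq]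
    congr 1
    funext t
    have h1 : HasDerivAt (fun t : ℝ => Real.exp (-t)) (Real.exp (-t) * (-1)) t :=
      (hasDerivAt_neg t).exp
    have h2 := (p.hasDerivAt t).mul h1
    have h3 : deriv (fun t : ℝ => p.eval t * Real.exp (-t)) t = _ := h2.deriv
    rw [h3]
    simp only [Polynomial.eval_sub]
    ring

/-- The Laguerre function is a polynomial times `e^{-z/2}`. -/
theorem exists_laguerreFun_eq (k : ℕ) :
    ∃ q : Polynomial ℝ, ∀ z : ℝ, laguerreFun k z = q.eval z * Real.exp (-(z / 2)) := by
  obtain ⟨q, hq⟩ := iteratedDeriv_poly_mul_exp_neg k (Polynomial.X ^ k)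
  refine ⟨Polynomial.C ((k.factorial : ℝ)⁻¹) * q, fun z => ?_⟩
  have hq' : iteratedDeriv k (fun t : ℝ => t ^ k * Real.exp (-t)) z =
      q.eval z * Real.exp (-z) := by
    have := congrFun hq z
    simpa using this
  have h2 : Real.exp (z / 2) * Real.exp (-z) = Real.exp (-(z / 2)) := by
    rw [← Real.exp_add]; congr 1; ring
  rw [laguerreFun, hq', ← h2]
  simp only [Polynomial.eval_mul, Polynomial.eval_C]
  ring

theorem one_add_pow_le_exp (M : ℕ) {r : ℝ} (hr : 0 ≤ r) :
    (1 + r) ^ M ≤ (2 * (M + 1)) ^ M * Real.exp (r ^ 2 / 2) := by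
  have hM : (0 : ℝ) < M + 1 := by positivity
  have h1 : 1 + r ≤ 2 * (M + 1) * Real.exp (r ^ 2 / 2 / (M + 1)) := by
    have h2 := Real.add_one_le_exp (r ^ 2 / 2 / (M + 1))
    have h3 : 2 * (M + 1) * (r ^ 2 / 2 / (M + 1) + 1) = r ^ 2 + 2 * (M + 1) := by
      field_simp
    have h4 : 2 * ((M : ℝ) + 1) * (r ^ 2 / 2 / (M + 1) + 1) ≤
        2 * (M + 1) * Real.exp (r ^ 2 / 2 / (M + 1)) := by gcongr
    have h5 : (0 : ℝ) ≤ M := by positivity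
    nlinarith [sq_nonneg (r - 1 / 2)]
  calc (1 + r) ^ M ≤ (2 * (M + 1) * Real.exp (r ^ 2 / 2 / (M + 1))) ^ M := by gcongr
    _ = (2 * (M + 1)) ^ M * Real.exp (M * (r ^ 2 / 2 / (M + 1))) := by
        rw [mul_pow, ← Real.exp_nat_mul]
    _ ≤ (2 * (M + 1)) ^ M * Real.exp (r ^ 2 / 2) := by
        gcongr
        have h6 : (M : ℝ) * (r ^ 2 / 2 / (M + 1)) = (M / (M + 1)) * (r ^ 2 / 2) := by
          field_simp
        rw [h6]
        have h7 : (M : ℝ) / (M + 1) ≤ 1 := by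
          rw [div_le_one hM]; linarith
        exact mul_le_of_le_one_left (by positivity) h7

/-- The Gaussian `e^{-|x|²/2}` as a Schwartz function on the plane. -/
def gaussianSchwartz : 𝓢(Plane, ℂ) where
  toFun x := ((Real.exp (-(‖x‖ ^ 2 / 2)) : ℝ) : ℂ)
  smooth' := Complex.ofRealCLM.contDiff.comp
    (Real.contDiff_exp.comp (((contDiff_norm_sq ℝ).div_const 2).neg))
  decay' := by
    intro m n
    have hf : (fun x : Plane => ‖x‖ ^ 2 / 2).HasTemperateGrowth := by
      have h := (Function.HasTemperateGrowth.const (E := Plane) (1 / 2 : ℝ)).mul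
        (Function.hasTemperateGrowth_norm_sq (H := Plane))
      have e : (fun x : Plane => ‖x‖ ^ 2 / 2) =
          (fun _ : Plane => (1 / 2 : ℝ)) * fun x : Plane => ‖x‖ ^ 2 := by
        funext x
        simp only [Pi.mul_apply]
        ring
      rw [e]
      exact h
    obtain ⟨j, C, hC, hb⟩ := hf.norm_iteratedFDeriv_le_uniform n
    set M : ℕ := m + j * n with hM
    refine ⟨n.factorial * (max 1 C) ^ n * (2 * (M + 1)) ^ M, fun x => ?_⟩
    have hg : ContDiff ℝ ∞ (fun t : ℝ => ((Real.exp (-t) : ℝ) : ℂ)) :=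
      Complex.ofRealCLM.contDiff.comp (Real.contDiff_exp.comp contDiff_neg)
    have hgd : ∀ i : ℕ, ∀ t : ℝ,
        ‖iteratedFDeriv ℝ i (fun t : ℝ => ((Real.exp (-t) : ℝ) : ℂ)) t‖ = Real.exp (-t) := by
      intro i t
      have e1 : (fun t : ℝ => ((Real.exp (-t) : ℝ) : ℂ)) =
          Complex.ofRealLI ∘ fun t : ℝ => Real.exp (-t) := rfl
      rw [e1, LinearIsometry.norm_iteratedFDeriv_comp_left Complex.ofRealLI
        (f := fun t : ℝ => Real.exp (-t)) (n := i) (i := i)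
        (Real.contDiff_exp.comp contDiff_neg).contDiffAt le_rfl,
        norm_iteratedFDeriv_eq_norm_iteratedDeriv]
      have e2 : (fun t : ℝ => Real.exp (-t)) = fun t : ℝ => Real.exp ((-1) * t) := by
        funext t; simp
      rw [e2, iteratedDeriv_exp_const_mul]
      simp [abs_of_pos (Real.exp_pos _)]
    have hx0 : (1 : ℝ) ≤ 1 + ‖x‖ := by linarith [norm_nonneg x]
    have hD1 : (1 : ℝ) ≤ max 1 C * (1 + ‖x‖) ^ j :=
      one_le_mul_of_one_le_of_one_le (le_max_left _ _) (one_le_pow₀ hx0)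
    have key := norm_iteratedFDeriv_comp_le (𝕜 := ℝ) (n := n)
      (g := fun t : ℝ => ((Real.exp (-t) : ℝ) : ℂ)) (f := fun x : Plane => ‖x‖ ^ 2 / 2)
      hg ((contDiff_norm_sq ℝ).div_const 2) (by exact_mod_cast le_top) x
      (C := Real.exp (-(‖x‖ ^ 2 / 2))) (D := max 1 C * (1 + ‖x‖) ^ j)
      (fun i _ => (hgd i _).le)
      (fun i hi hin => by
        refine (hb i hin x).trans ?_
        refine le_trans ?_ (le_self_pow₀ hD1 (by omega))
        gcongr
        exact le_max_right _ _)
    have e3 : (fun t : ℝ => ((Real.exp (-t) : ℝ) : ℂ)) ∘ (fun x : Plane => ‖x‖ ^ 2 / 2) =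
        fun x : Plane => ((Real.exp (-(‖x‖ ^ 2 / 2)) : ℝ) : ℂ) := rfl
    rw [e3] at key
    have hxm : ‖x‖ ^ m ≤ (1 + ‖x‖) ^ m := by gcongr; linarith
    have hexp := one_add_pow_le_exp M (norm_nonneg x)
    have hone : Real.exp (‖x‖ ^ 2 / 2) * Real.exp (-(‖x‖ ^ 2 / 2)) = 1 := by
      rw [← Real.exp_add]; simp
    calc ‖x‖ ^ m * ‖iteratedFDeriv ℝ n
            (fun x : Plane => ((Real.exp (-(‖x‖ ^ 2 / 2)) : ℝ) : ℂ)) x‖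
        ≤ (1 + ‖x‖) ^ m * (n.factorial * Real.exp (-(‖x‖ ^ 2 / 2)) *
            (max 1 C * (1 + ‖x‖) ^ j) ^ n) := by gcongr
      _ = n.factorial * (max 1 C) ^ n * ((1 + ‖x‖) ^ M) * Real.exp (-(‖x‖ ^ 2 / 2)) := by
          rw [hM, pow_add, pow_mul, mul_pow]; ring
      _ ≤ n.factorial * (max 1 C) ^ n * ((2 * (M + 1)) ^ M * Real.exp (‖x‖ ^ 2 / 2)) *
            Real.exp (-(‖x‖ ^ 2 / 2)) := by gcongr
      _ = n.factorial * (max 1 C) ^ n * (2 * (M + 1)) ^ M := by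
          linear_combination (n.factorial * (max 1 C) ^ n * (2 * ((M : ℝ) + 1)) ^ M) * hone

theorem hasTemperateGrowth_poly_norm_sq (q : Polynomial ℝ) :
    (fun x : Plane => ((q.eval (‖x‖ ^ 2) : ℝ) : ℂ)).HasTemperateGrowth := by
  have h : (fun x : Plane => q.eval (‖x‖ ^ 2)).HasTemperateGrowth := by
    have e : (fun x : Plane => q.eval (‖x‖ ^ 2)) =
        fun x => ∑ i ∈ Finset.range (q.natDegree + 1), q.coeff i * (‖x‖ ^ 2) ^ i := by
      funext x; exact Polynomial.eval_eq_sum_range _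
    rw [e]
    refine Function.HasTemperateGrowth.sum fun i _ => ?_
    exact (Function.HasTemperateGrowth.const (E := Plane) (q.coeff i)).mul
      ((Function.hasTemperateGrowth_norm_sq (H := Plane)).pow i)
  exact Function.HasTemperateGrowth.comp Complex.ofRealCLM.hasTemperateGrowth h

/-- `π^{-1/2} ℒ_k⁰(|x|²)` is the pointwise value of a Schwartz function. -/
theorem exists_schwartz_eq_laguerreFun (k : ℕ) : ∃ φ : 𝓢(Plane, ℂ), ∀ x : Plane,
    φ x = (((1 / Real.sqrt Real.pi) * laguerreFun k (‖x‖ ^ 2) : ℝ) : ℂ) := by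
  obtain ⟨q, hq⟩ := exists_laguerreFun_eq k
  refine ⟨((1 / Real.sqrt Real.pi : ℝ) : ℂ) • SchwartzMap.smulLeftCLM ℂ
    (fun x : Plane => ((q.eval (‖x‖ ^ 2) : ℝ) : ℂ)) gaussianSchwartz, fun x => ?_⟩
  have hg : gaussianSchwartz x = ((Real.exp (-(‖x‖ ^ 2 / 2)) : ℝ) : ℂ) := rfl
  rw [smul_apply,
    SchwartzMap.smulLeftCLM_apply_apply (hasTemperateGrowth_poly_norm_sq q), hg, hq]
  push_cast
  simp only [smul_eq_mul]

/-- The radial eigenfunctions `e_k(x) = π^{-1/2} ℒ_k⁰(|x|²)`, as Schwartz functions on `ℝ²`. -/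
def eigenfun (k : ℕ) : 𝓢(Plane, ℂ) where
  toFun x := (((1 / Real.sqrt Real.pi) * laguerreFun k (‖x‖ ^ 2) : ℝ) : ℂ)
  smooth' := by
    obtain ⟨φ, hφ⟩ := exists_schwartz_eq_laguerreFun k
    rw [← funext hφ]
    exact φ.smooth'
  decay' := by
    obtain ⟨φ, hφ⟩ := exists_schwartz_eq_laguerreFun k
    rw [← funext hφ]
    exact φ.decay'

/-- The Hermite operator `H = -Δ + |x|²` on Schwartz functions on the plane. -/
def hermiteOp (φ : 𝓢(Plane, ℂ)) : 𝓢(Plane, ℂ) :=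
  -(Δ φ) + SchwartzMap.smulLeftCLM ℂ (fun x : Plane => ((‖x‖ ^ 2 : ℝ) : ℂ)) φ

theorem iteratedDeriv_id_mul {f : ℝ → ℝ} (hf : ContDiff ℝ ∞ f) (n : ℕ) (z : ℝ) :
    iteratedDeriv (n + 1) (fun t => t * f t) z =
      z * iteratedDeriv (n + 1) f z + (n + 1) * iteratedDeriv n f z := by
  induction n generalizing z with
  | zero =>
    have h1 : HasDerivAt f (deriv f z) z :=
      (hf.differentiable (by simp) z).hasDerivAt
    have h3 : deriv (fun t => t * f t) z = _ := ((hasDerivAt_id z).mul h1).deriv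
    simp only [zero_add, iteratedDeriv_one, iteratedDeriv_zero, Nat.cast_zero, h3]
    simp only [id]
    ring
  | succ n ih =>
    have hd : ∀ m : ℕ, HasDerivAt (iteratedDeriv m f) (iteratedDeriv (m + 1) f z) z := by
      intro m
      rw [iteratedDeriv_succ]
      exact (hf.differentiable_iteratedDeriv m (by exact_mod_cast WithTop.coe_lt_top _) z).hasDerivAt
    rw [iteratedDeriv_succ, funext ih]
    have h3 := (((hasDerivAt_id z).mul (hd (n + 1))).add ((hd n).const_mul ((n : ℝ) + 1))).deriv
    refine Eq.trans h3 ?_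
    simp only [id]
    push_cast
    ring

/-- The differential equation satisfied by `W(z) = (d/dz)^k (z^k e^{-z})`. -/
theorem rodrigues_ode (k : ℕ) (z : ℝ) :
    z * iteratedDeriv (k + 2) (fun t : ℝ => t ^ k * Real.exp (-t)) z +
      (z + 1) * iteratedDeriv (k + 1) (fun t : ℝ => t ^ k * Real.exp (-t)) z +
      (k + 1) * iteratedDeriv k (fun t : ℝ => t ^ k * Real.exp (-t)) z = 0 := by
  set w : ℝ → ℝ := fun t : ℝ => t ^ k * Real.exp (-t) with hw
  have hwc : ContDiff ℝ ∞ w :=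
    (contDiff_id.pow k).mul (Real.contDiff_exp.comp contDiff_neg)
  have hwd : ContDiff ℝ ∞ (deriv w) := by
    have := (contDiff_infty_iff_deriv.1 hwc).2
    exact this
  have h1 : ∀ t : ℝ, t * deriv w t = k * w t - t * w t := by
    intro t
    have h2 : HasDerivAt (fun t : ℝ => Real.exp (-t)) (Real.exp (-t) * (-1)) t :=
      (hasDerivAt_neg t).exp
    have h3 : deriv w t = _ := ((hasDerivAt_pow k t).mul h2).deriv
    rw [h3, hw]
    rcases k with _ | k
    · simp
    · simp only [Nat.add_sub_cancel, pow_succ]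
      ring
  have h4 := iteratedDeriv_id_mul hwd k z
  have h5 := iteratedDeriv_id_mul hwc k z
  rw [funext h1] at h4
  have hsub : iteratedDeriv (k + 1) (fun t => (k : ℝ) * w t - t * w t) z =
      k * iteratedDeriv (k + 1) w z - iteratedDeriv (k + 1) (fun t => t * w t) z := by
    have h6 : iteratedDeriv (k + 1) (fun t => (k : ℝ) * w t - t * w t) z =
        iteratedDeriv (k + 1) (fun t => (k : ℝ) * w t) z -
          iteratedDeriv (k + 1) (fun t => t * w t) z :=
      iteratedDeriv_sub (n := k + 1)
        ((contDiff_const.mul hwc).of_le (by exact_mod_cast le_top)).contDiffAt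
        ((contDiff_id.mul hwc).of_le (by exact_mod_cast le_top)).contDiffAt
    rw [h6, iteratedDeriv_const_mul_field]
  rw [hsub, h5, ← iteratedDeriv_succ', ← iteratedDeriv_succ'] at h4
  linear_combination -h4

/-- The functions `e_k` are eigenfunctions of `H` with eigenvalue `4k + 2`. -/
theorem hermiteOp_eigenfun (k : ℕ) :
    hermiteOp (eigenfun k) = ((4 * k + 2 : ℝ) : ℂ) • eigenfun k := by
  set w : ℝ → ℝ := fun t : ℝ => t ^ k * Real.exp (-t) with hw
  have hwc : ContDiff ℝ ∞ w :=
    (contDiff_id.pow k).mul (Real.contDiff_exp.comp contDiff_neg)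
  set c : ℝ := 1 / Real.sqrt Real.pi / k.factorial with hc
  set W : ℕ → ℝ → ℝ := fun m => iteratedDeriv m w with hW
  have hWd : ∀ (m : ℕ) (z : ℝ), HasDerivAt (W m) (W (m + 1) z) z := by
    intro m z
    simp only [hW]
    rw [iteratedDeriv_succ]
    exact (hwc.differentiable_iteratedDeriv m (by exact_mod_cast WithTop.coe_lt_top _) z).hasDerivAt
  have hE : ∀ z : ℝ, HasDerivAt (fun z : ℝ => Real.exp (z / 2)) (Real.exp (z / 2) * (1 / 2)) z :=
    fun z => ((hasDerivAt_id z).div_const 2).exp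
  set F : ℝ → ℝ := fun z => Real.exp (z / 2) * (c * W k z) with hF
  set F1 : ℝ → ℝ := fun z => Real.exp (z / 2) * (c * (W (k + 1) z + W k z / 2)) with hF1
  set F2 : ℝ → ℝ := fun z =>
    Real.exp (z / 2) * (c * (W (k + 2) z + W (k + 1) z + W k z / 4)) with hF2
  have hFd : ∀ z, HasDerivAt F (F1 z) z := fun z => by
    refine ((hE z).mul ((hWd k z).const_mul c)).congr_deriv ?_
    simp only [hF1]
    ring
  have hF1d : ∀ z, HasDerivAt F1 (F2 z) z := fun z => by
    refine ((hE z).mul (((hWd (k + 1) z).add ((hWd k z).div_const 2)).const_mul c)).congr_deriv ?_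
    simp only [Pi.add_apply, hF2]
    ring
  have hval : ∀ x : Plane, eigenfun k x = ((F (‖x‖ ^ 2) : ℝ) : ℂ) := by
    intro x
    change (((1 / Real.sqrt Real.pi) * laguerreFun k (‖x‖ ^ 2) : ℝ) : ℂ) = _
    congr 1
    simp only [laguerreFun, hF, hc, hW, hw]
    ring
  have hN : ∀ x b : Plane, HasDerivAt (fun t : ℝ => ‖x + t • b‖ ^ 2) (2 * inner ℝ x b) 0 := by
    intro x b
    have h1 : HasDerivAt (fun t : ℝ => x + t • b) b 0 := by
      simpa using ((hasDerivAt_id (0 : ℝ)).smul_const b).const_add x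
    simpa using h1.norm_sq
  have hI : ∀ x b : Plane, HasDerivAt (fun t : ℝ => inner ℝ (x + t • b) b) (inner ℝ b b) 0 := by
    intro x b
    have h1 : HasDerivAt (fun t : ℝ => x + t • b) b 0 := by
      simpa using ((hasDerivAt_id (0 : ℝ)).smul_const b).const_add x
    simpa using h1.inner ℝ (hasDerivAt_const (0 : ℝ) b)
  have hG : ∀ (G G' : ℝ → ℝ), (∀ z, HasDerivAt G (G' z) z) → ∀ x b : Plane,
      HasDerivAt (fun t : ℝ => G (‖x + t • b‖ ^ 2)) (G' (‖x‖ ^ 2) * (2 * inner ℝ x b)) 0 := by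
    intro G G' h x b
    have h0 : HasDerivAt G (G' (‖x‖ ^ 2)) (‖x + (0 : ℝ) • b‖ ^ 2) := by simpa using h (‖x‖ ^ 2)
    exact HasDerivAt.comp (0 : ℝ) h0 (hN x b)
  have hd1 : ∀ b x : Plane, (∂_{b} (eigenfun k)) x =
      ((F1 (‖x‖ ^ 2) * (2 * inner ℝ x b) : ℝ) : ℂ) := by
    intro b x
    rw [SchwartzMap.lineDerivOp_apply, lineDeriv]
    simp only [hval]
    exact (hG F F1 hFd x b).ofReal_comp.deriv
  have hd2 : ∀ b x : Plane, (∂_{b} (∂_{b} (eigenfun k))) x =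
      ((F2 (‖x‖ ^ 2) * (2 * inner ℝ x b) * (2 * inner ℝ x b) +
        F1 (‖x‖ ^ 2) * (2 * inner ℝ b b) : ℝ) : ℂ) := by
    intro b x
    rw [SchwartzMap.lineDerivOp_apply, lineDeriv]
    simp only [hd1]
    have h := ((hG F1 F2 hF1d x b).mul ((hI x b).const_mul 2)).ofReal_comp.deriv
    refine Eq.trans h ?_
    simp
  ext x
  have hlap : (Δ (eigenfun k)) x =
      ((4 * ‖x‖ ^ 2 * F2 (‖x‖ ^ 2) + 4 * F1 (‖x‖ ^ 2) : ℝ) : ℂ) := by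
    rw [SchwartzMap.laplacian_eq_sum (EuclideanSpace.basisFun (Fin 2) ℝ), Fin.sum_univ_two,
      add_apply, hd2, hd2, ← Complex.ofReal_add]
    congr 1
    have hn : ‖x‖ ^ 2 = x 0 ^ 2 + x 1 ^ 2 := by
      rw [EuclideanSpace.real_norm_sq_eq, Fin.sum_univ_two]
    simp only [OrthonormalBasis.inner_eq_one, EuclideanSpace.inner_basisFun_real]
    rw [hn]
    ring
  have hq : (fun x : Plane => ((‖x‖ ^ 2 : ℝ) : ℂ)).HasTemperateGrowth := by
    simpa using hasTemperateGrowth_poly_norm_sq Polynomial.X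
  rw [hermiteOp, add_apply, neg_apply, hlap, SchwartzMap.smulLeftCLM_apply_apply hq,
    smul_apply, hval, smul_eq_mul, smul_eq_mul, ← Complex.ofReal_mul, ← Complex.ofReal_mul,
    ← Complex.ofReal_neg, ← Complex.ofReal_add]
  congr 1
  have ode := rodrigues_ode k (‖x‖ ^ 2)
  simp only [hF, hF1, hF2, hW]
  linear_combination (-4 * c * Real.exp (‖x‖ ^ 2 / 2)) * ode

/-- The terms of the eigenfunction expansion of `H^s u`, where `⟨u, e_k⟩ = u(e_k)`.
Since `(e_k)` is the complete system of real radial eigenfunctions of `H`, with eigenvalues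
`4k + 2`, the functional calculus gives `H^s u = ∑_k (4k+2)^s ⟨u, e_k⟩ e_k` for radial `u`,
the series being taken in the space of tempered distributions. -/
def hermitePowTerm (s : ℝ) (u : 𝓢'(Plane, ℂ)) (k : ℕ) : 𝓢'(Plane, ℂ) :=
  ((((4 * k + 2 : ℝ) ^ s : ℝ) : ℂ) * u (eigenfun k)) • (eigenfun k : 𝓢'(Plane, ℂ))

/-- `H^s u = ∑_k (4k+2)^s ⟨u, e_k⟩ e_k` for a radial tempered distribution `u`. -/
def hermitePow (s : ℝ) (u : 𝓢'(Plane, ℂ)) : 𝓢'(Plane, ℂ) :=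
  ∑' k : ℕ, hermitePowTerm s u k

/-! ### The random series -/

/-- The normalized complex Gaussian law, with density `π⁻¹ e^{-|z|²}` on `ℂ`. -/
def stdComplexGaussian : Measure ℂ :=
  volume.withDensity fun z : ℂ => ENNReal.ofReal (1 / Real.pi * Real.exp (-‖z‖ ^ 2))

/-- The `k`-th term `(4k+2)^{-1/2} g_k(w) e_k` of the random series. -/
def randomSeriesTerm {Ω : Type*} (g : ℕ → Ω → ℂ) (w : Ω) (k : ℕ) : 𝓢'(Plane, ℂ) :=
  (((1 / Real.sqrt (4 * k + 2) : ℝ) : ℂ) * g k w) • (eigenfun k : 𝓢'(Plane, ℂ))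

/-- The random tempered distribution `f(w) = ∑_k (4k+2)^{-1/2} g_k(w) e_k`. -/
def randomSeries {Ω : Type*} (g : ℕ → Ω → ℂ) (w : Ω) : 𝓢'(Plane, ℂ) :=
  ∑' k : ℕ, randomSeriesTerm g w k

/-! ### Distributions given by functions -/

/-- The tempered distribution `v` is (given by) a function in `L¹(ℝ²)`. -/
def IsL1Distribution (v : 𝓢'(Plane, ℂ)) : Prop :=
  ∃ h : Lp ℂ 1 (volume : Measure Plane), (h : 𝓢'(Plane, ℂ)) = v

/-- The tempered distribution `v` is (given by) a locally integrable function on `ℝ²`. -/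
def IsLocallyIntegrableDistribution (v : 𝓢'(Plane, ℂ)) : Prop :=
  ∃ h : Plane → ℂ, LocallyIntegrable h volume ∧
    ∀ φ : 𝓢(Plane, ℂ), HasCompactSupport φ → v φ = ∫ x, φ x * h x

end

noncomputable section

/-! ### Growth of the sums of squares of Laguerre polynomials -/

/-! Write `v` for the distribution with coefficients `(4k+2)^{(σ-1)/2} g_k`. At a fixed `x ≠ 0` its
formal variance is a multiple of `∑ (4k+2)^{σ-1} e_k(x)²`. On average `e_k(x)²` has size at least
`k^{-1/2}`, so for `σ ≥ 1/2` this sum diverges: pointwise the field is infinitely large.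

The divergence rests on `exists_sqrt_le_sum_sq`, which bounds `∑_{j≤k} L_j(z)²` below by `c√k` for
`z > 0`. A Christoffel–Darboux identity turns the sum into a quadratic energy. A corrected energy
without the leading oscillation then obeys a recursion that forces growth of order `√k`.

To give the pointwise heuristic a meaning, `v` is mollified at scale `1/(n+1)`. The real part of the
mollified field at `x` is a sum of independent Gaussians, and its variance diverges in the iterated
limit of small scales and long partial sums. Gaussian anti-concentration, Fubini and Fatou
(`ae_liminf_measure_abs_lt_eq_zero`) show that almost surely, for each `M`, the part of a given ball
where the mollification stays below `M` has measure with lower limit zero. If `v` were an integrable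
function near the ball, its mollifications would be bounded in `L¹` there, and Markov's inequality
contradicts this (`not_agreesOn_of_liminf`).

Countably many balls and levels `M` suffice, so one null set serves all `ψ`: where `ψ ≠ 0`,
integrability of `ψ v` makes `v` an integrable function on a small ball. Convergence in the tempered
distributions is softer: `H^N` moves to the test function, and the coefficients grow at most
polynomially in a summable sense (`summable_smul_eigenfun`, `ae_summable_norm_gaussian`). -/

theorem sqrt_pred_ge {s : ℝ} (hs : 1 ≤ s) :
    s - 1 / (2 * s) - 1 / (2 * s ^ 3) ≤ Real.sqrt (s ^ 2 - 1) := by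
  apply Real.le_sqrt_of_sq_le
  have hs0 : 0 < s := by linarith
  have h : (s - 1 / (2 * s) - 1 / (2 * s ^ 3)) ^ 2 =
      s ^ 2 - 1 - (3 / 4) / s ^ 2 + (1 / 2) / s ^ 4 + (1 / 4) / s ^ 6 := by
    field_simp
    ring
  rw [h]
  have h4 : (1 / 2) / s ^ 4 ≤ (1 / 2) / s ^ 2 := by
    gcongr _ / ?_
    exact pow_le_pow_right₀ hs (by norm_num)
  have h6 : (1 / 4) / s ^ 6 ≤ (1 / 4) / s ^ 2 := by
    gcongr _ / ?_
    exact pow_le_pow_right₀ hs (by norm_num)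
  have h2 : (3 / 4) / s ^ 2 = (1 / 2) / s ^ 2 + (1 / 4) / s ^ 2 := by ring
  linarith

/-- `√n + B` is a subsolution of the recursion `V_{n-1} = (1 - 1/(2n) + C n^{-3/2}) V_n`. -/
theorem sqrt_add_const_subsolution {C s : ℝ} (hs : 1 ≤ s)
    (hsC : C * (2 * C + 2) + 1 / 2 ≤ s) :
    (s + (2 * C + 2)) * (1 - 1 / (2 * s ^ 2) + C / s ^ 3) ≤
      Real.sqrt (s ^ 2 - 1) + (2 * C + 2) := by
  have hs0 : 0 < s := by linarith
  refine le_trans ?_ (add_le_add_left (sqrt_pred_ge hs) _)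
  -- With `B = 2C + 2` one has `B/2 - C = 1`, so the difference is `s⁻² - (CB + 1/2) s⁻³`,
  -- nonnegative for large `s`.
  have h : s - 1 / (2 * s) - 1 / (2 * s ^ 3) + (2 * C + 2) -
      (s + (2 * C + 2)) * (1 - 1 / (2 * s ^ 2) + C / s ^ 3) =
      (s - (C * (2 * C + 2) + 1 / 2)) / s ^ 3 := by
    field_simp
    ring
  have h2 : 0 ≤ (s - (C * (2 * C + 2) + 1 / 2)) / s ^ 3 :=
    div_nonneg (by linarith) (by positivity)
  linarith

section Recurrence

variable {z : ℝ} {L d : ℕ → ℝ}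

/-- A Christoffel–Darboux identity. -/
theorem christoffel_darboux (hL0 : L 0 = 1) (hd0 : d 0 = 0)
    (hd : ∀ k, d (k + 1) = d k - z * L k)
    (hL : ∀ k : ℕ, (k + 1) * (L (k + 1) - L k) = d (k + 1)) (k : ℕ) :
    z * ∑ j ∈ Finset.range (k + 1), L j ^ 2 =
      d k ^ 2 - z * d k * L k + (k + 1) * z * L k ^ 2 := by
  induction k with
  | zero => simp [hL0, hd0]
  | succ k ih =>
    rw [Finset.sum_range_succ, mul_add, ih]
    have h1 : d k = d (k + 1) + z * L k := by rw [hd]; ring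
    rw [h1]
    push_cast
    linear_combination (-z * (L (k + 1) + L k)) * hL k

/-- Here `p`, `b`, `I` stand for `d n`, `L n` and the Christoffel–Darboux energy. For `n ≥ z`
completing the square gives `p² + n z b² ≤ 2I`, whence `|p b| ≤ I/√(nz)` and `z b² ≤ 2I/n`. The
corrections in `2I - z b² + p b` are thus of lower order, and the error in its recursion is of
relative size `n^{-3/2}`. -/
theorem laguerre_energy_bounds {z n p b I : ℝ} (hz : 0 < z) (hn4 : 4 ≤ n) (hzn : z ≤ n)
    (h4z : 4 / z ≤ n) (hIe : I = p ^ 2 - z * p * b + (n + 1) * z * b ^ 2) (hIp : 0 < I) :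
    I ≤ 2 * I - z * b ^ 2 + p * b ∧ 2 * I - z * b ^ 2 + p * b ≤ 3 * I ∧
      -((z - 1 / 2) * (p * b) - 1 / 2 * (z * b ^ 2)) / n ≤
        ((z + 1 / 2) / Real.sqrt z + 1) / Real.sqrt n ^ 3 * (2 * I - z * b ^ 2 + p * b) := by
  have hn0 : 0 < n := by linarith
  have hs0 : 0 < Real.sqrt n := Real.sqrt_pos.2 hn0
  have hss : Real.sqrt n ^ 2 = n := Real.sq_sqrt hn0.le
  have ht0 : 0 < Real.sqrt z := Real.sqrt_pos.2 hz
  have htt : Real.sqrt z ^ 2 = z := Real.sq_sqrt hz.le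
  have hs1 : 1 ≤ Real.sqrt n := Real.one_le_sqrt.2 (by linarith)
  have hzb : 0 ≤ z * b ^ 2 := by positivity
  generalize Real.sqrt n = s at *
  generalize Real.sqrt z = t at *
  have hIl : p ^ 2 + n * z * b ^ 2 ≤ 2 * I := by
    rw [hIe]
    have : 0 ≤ (n - z) * z * b ^ 2 := by
      have : 0 ≤ n - z := by linarith
      positivity
    nlinarith [sq_nonneg (p - z * b)]
  have hD : |p * b| * (s * t) ≤ I := by
    have e : (s * t * |b|) ^ 2 = n * z * b ^ 2 := by
      rw [mul_pow, mul_pow, hss, htt, sq_abs]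
    have h1 := two_mul_le_add_sq |p| (s * t * |b|)
    rw [e, sq_abs] at h1
    rw [abs_mul]
    linarith
  have hst0 : 0 < s * t := by positivity
  have hD' : |p * b| ≤ I / (s * t) := by
    rwa [le_div_iff₀ hst0]
  have hδ : z * b ^ 2 ≤ 2 * I / n := by
    rw [le_div_iff₀ hn0]
    nlinarith [sq_nonneg p]
  have hδ' : z * b ^ 2 ≤ I / 2 := by
    refine hδ.trans ?_
    rw [div_le_div_iff₀ hn0 two_pos]
    nlinarith
  have hst : 2 ≤ s * t := by
    have h1 : 2 ^ 2 ≤ (s * t) ^ 2 := by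
      rw [mul_pow, hss, htt]
      have := (div_le_iff₀ hz).1 h4z
      linarith
    exact le_of_sq_le_sq h1 hst0.le
  have hD2 : |p * b| ≤ I / 2 := hD'.trans (by gcongr)
  have habs := abs_le.1 hD2
  generalize hV : 2 * I - z * b ^ 2 + p * b = V
  have hVI : I ≤ V := by linarith
  refine ⟨hVI, by linarith, ?_⟩
  have herr : -((z - 1 / 2) * (p * b) - 1 / 2 * (z * b ^ 2)) ≤ ((z + 1 / 2) / t + 1) / s * V := by
    have e1 : -((z - 1 / 2) * (p * b)) ≤ (z + 1 / 2) * |p * b| := by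
      have h1 : |z - 1 / 2| ≤ z + 1 / 2 := by rw [abs_le]; constructor <;> linarith
      calc _ ≤ |(z - 1 / 2) * (p * b)| := neg_le_abs _
        _ = |z - 1 / 2| * |p * b| := abs_mul _ _
        _ ≤ _ := by gcongr
    have e2 : (z + 1 / 2) * |p * b| ≤ (z + 1 / 2) * (V / (s * t)) := by
      gcongr
      exact hD'.trans (by gcongr)
    have e3 : z * b ^ 2 ≤ 2 * V / s := by
      refine hδ.trans ?_
      have h1 : s ≤ n := by rw [← hss]; nlinarith
      have h2 : 0 ≤ 2 * V := by linarith
      gcongr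
    have e4 : ((z + 1 / 2) / t + 1) / s * V = (z + 1 / 2) * (V / (s * t)) + V / s := by
      field_simp
    have e7 : 2 * V / s = 2 * (V / s) := by ring
    rw [e4]
    linarith
  have h3 : ((z + 1 / 2) / t + 1) / s ^ 3 * V = (((z + 1 / 2) / t + 1) / s * V) / n := by
    rw [← hss]; field_simp
  rw [h3]
  exact div_le_div_of_nonneg_right herr hn0.le

/-- The energy `I` grows by `z L²`, which oscillates. To leading order `d L` changes by `d²/n - z
L²`, so `2I + d L` changes by `d²/n + z L² ≈ I/n`, half its own size divided by `n`. This yields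
growth like `√n`, made rigorous by comparison with the subsolution `√n + B`. -/
theorem exists_sqrt_le_sum_sq (hz : 0 < z) (hL0 : L 0 = 1) (hd0 : d 0 = 0)
    (hd : ∀ k, d (k + 1) = d k - z * L k)
    (hL : ∀ k : ℕ, (k + 1) * (L (k + 1) - L k) = d (k + 1)) :
    ∃ c > 0, ∃ K : ℕ, ∀ k ≥ K, c * Real.sqrt k ≤ ∑ j ∈ Finset.range (k + 1), L j ^ 2 := by
  set I : ℕ → ℝ := fun k => d k ^ 2 - z * d k * L k + (k + 1) * z * L k ^ 2 with hI
  have hCD := christoffel_darboux hL0 hd0 hd hL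
  have hIpos : ∀ k, 0 < I k := by
    intro k
    simp only [hI]
    rw [← hCD k, Finset.sum_range_succ', hL0]
    positivity
  set V : ℕ → ℝ := fun k => 2 * I k - z * L k ^ 2 + d k * L k with hV
  set C : ℝ := (z + 1 / 2) / Real.sqrt z + 1 with hC
  have hC0 : 0 ≤ C := by positivity
  have hVrec : ∀ k : ℕ, V (k + 1) * (1 - 1 / (2 * (k + 1))) =
      V k + ((z - 1 / 2) * (d (k + 1) * L (k + 1)) - 1 / 2 * (z * L (k + 1) ^ 2)) / (k + 1) := by
    intro k
    have h1 : d k = d (k + 1) + z * L k := by rw [hd]; ring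
    have hk : (k : ℝ) + 1 ≠ 0 := by positivity
    simp only [hV, hI]
    rw [h1, ← hL k]
    push_cast
    field_simp
    ring
  -- Beyond `N` both the energy bounds (`z`, `4`, `4/z`) and the subsolution inequality (`C(2C+2) +
  -- 1/2 ≤ √n`) are available.
  obtain ⟨N, hN⟩ := exists_nat_ge
    (max (max 1 z) (max (max 4 (4 / z)) ((C * (2 * C + 2) + 1 / 2) ^ 2)))
  simp only [max_le_iff] at hN
  obtain ⟨⟨hN1, hNz⟩, ⟨hN4, hN4z⟩, hNC⟩ := hN
  have key : ∀ k : ℕ, N ≤ k → I (k + 1) ≤ V (k + 1) ∧ V (k + 1) ≤ 3 * I (k + 1) ∧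
      V k ≤ V (k + 1) * (1 - 1 / (2 * Real.sqrt (k + 1) ^ 2) + C / Real.sqrt (k + 1) ^ 3) := by
    intro k hk
    have hkN : (N : ℝ) ≤ k := by exact_mod_cast hk
    have hIe : I (k + 1) = d (k + 1) ^ 2 - z * d (k + 1) * L (k + 1) +
        (((k : ℝ) + 1) + 1) * z * L (k + 1) ^ 2 := by
      simp only [hI]; push_cast; ring
    obtain ⟨h1, h2, h3⟩ := laguerre_energy_bounds (n := (k : ℝ) + 1) hz (by linarith)
      (by linarith) (by linarith) hIe (hIpos _)
    refine ⟨h1, h2, ?_⟩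
    have hrec := hVrec k
    rw [Real.sq_sqrt (by positivity), mul_add, hrec]
    have h4 : V (k + 1) * (C / Real.sqrt ((k : ℝ) + 1) ^ 3) =
      C / Real.sqrt ((k : ℝ) + 1) ^ 3 * V (k + 1) := mul_comm _ _
    rw [neg_div] at h3
    rw [h4]
    linarith
  have hVN : 0 < V (N + 1) := (hIpos _).trans_le (key N le_rfl).1
  set B := 2 * C + 2 with hB
  have hB0 : 0 < B := by positivity
  -- Chosen so that the comparison starts with equality.
  set c := V (N + 1) / (Real.sqrt ((N : ℝ) + 1) + B) with hc
  have hc0 : 0 < c := by positivity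
  have hlow : ∀ m : ℕ, c * (Real.sqrt ((N + m : ℕ) + 1) + B) ≤ V (N + m + 1) := by
    intro m
    induction m with
    | zero =>
      simp only [add_zero]
      rw [hc, div_mul_cancel₀ _ (by positivity)]
    | succ m ih =>
      obtain ⟨-, -, h3⟩ := key (N + m + 1) (by omega)
      set s := Real.sqrt (((N + m + 1 : ℕ) : ℝ) + 1) with hs
      have hnn : (N : ℝ) ≤ (N + m + 1 : ℕ) := by exact_mod_cast (by omega)
      have hs1 : 1 ≤ s := Real.one_le_sqrt.2 (by linarith)
      have hsC : C * (2 * C + 2) + 1 / 2 ≤ s := by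
        apply Real.le_sqrt_of_sq_le
        linarith
      have hsub := sqrt_add_const_subsolution hs1 hsC
      have hss : s ^ 2 = ((N + m : ℕ) + 1 : ℝ) + 1 := by
        rw [hs, Real.sq_sqrt (by positivity)]; push_cast; ring
      have hpred : s ^ 2 - 1 = ((N + m : ℕ) + 1 : ℝ) := by rw [hss]; ring
      rw [hpred] at hsub
      -- The recursion bounds the earlier energy by this factor times the later one; its positivity
      -- allows the factor to be cancelled.
      have hρ : 0 < 1 - 1 / (2 * s ^ 2) + C / s ^ 3 := by
        have h1 : 1 / (2 * s ^ 2) ≤ 1 / 2 := by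
          apply one_div_le_one_div_of_le two_pos
          nlinarith
        have h2 : 0 ≤ C / s ^ 3 := by positivity
        linarith
      have h6 : c * (s + B) * (1 - 1 / (2 * s ^ 2) + C / s ^ 3) ≤
          V (N + m + 1 + 1) * (1 - 1 / (2 * s ^ 2) + C / s ^ 3) := by
        refine le_trans ?_ (ih.trans h3)
        rw [mul_assoc]
        gcongr
      exact le_of_mul_le_mul_right h6 hρ
  refine ⟨c / (3 * z), by positivity, N + 1, fun k hk => ?_⟩
  obtain ⟨m, rfl⟩ : ∃ m, k = N + m + 1 := ⟨k - (N + 1), by omega⟩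
  have h1 := hlow m
  have h2 := (key (N + m) (by omega)).2.1
  have h3 := hCD (N + m + 1)
  have h4 : z * ∑ j ∈ Finset.range (N + m + 1 + 1), L j ^ 2 = I (N + m + 1) := h3
  have h5 : Real.sqrt ((N + m + 1 : ℕ) : ℝ) = Real.sqrt ((N + m : ℕ) + 1) := by push_cast; rfl
  rw [h5, div_mul_eq_mul_div, div_le_iff₀ (by positivity)]
  have h6 : 0 ≤ c * B := by positivity
  nlinarith

/-- Sums weighted by `(4k+2)^{-1/2}` diverge if the partial sums grow like `√k`. -/
theorem not_summable_of_sqrt_le {b : ℕ → ℝ} (hb : ∀ k, 0 ≤ b k)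
    (h : ∃ c > 0, ∃ K : ℕ, ∀ k ≥ K, c * Real.sqrt k ≤ ∑ j ∈ Finset.range (k + 1), b j) :
    ¬ Summable fun k : ℕ => (1 / Real.sqrt (4 * k + 2)) * b k := by
  rintro hs
  obtain ⟨c, hc, K, hK⟩ := h
  have hnn : ∀ k : ℕ, 0 ≤ (1 / Real.sqrt (4 * k + 2)) * b k := fun k =>
    mul_nonneg (by positivity) (hb k)
  have htail := tendsto_sum_nat_add fun k : ℕ => (1 / Real.sqrt (4 * k + 2)) * b k
  -- Since `√(4k+2) ≤ 3√k`, a weighted tail below `c/6` contributes at most `(c/2)√k` to the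
  -- unweighted sum. The fixed head `S` would have to supply the other `(c/2)√k`, which fails for
  -- large `k`.
  obtain ⟨m, hm⟩ := ((tendsto_order.1 htail).2 (c / 6) (by positivity)).exists
  set S := ∑ j ∈ Finset.range m, b j with hS
  obtain ⟨k, hk⟩ := exists_nat_ge (max (max 1 (K : ℝ)) (max (m : ℝ) ((2 * S / c) ^ 2 + 1)))
  simp only [max_le_iff] at hk
  obtain ⟨⟨hk1, hkK⟩, hkm, hkS⟩ := hk
  have hkm' : m ≤ k := by exact_mod_cast hkm
  have h1 := hK k (by exact_mod_cast hkK)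
  obtain ⟨j, hj⟩ : ∃ j, k + 1 = m + j := ⟨k + 1 - m, by omega⟩
  rw [hj, Finset.sum_range_add] at h1
  have hsum : ∑ i ∈ Finset.range j, b (m + i) ≤ Real.sqrt (4 * k + 2) * (c / 6) := by
    have hle : ∑ i ∈ Finset.range j, (1 / Real.sqrt (4 * (i + m : ℕ) + 2)) * b (i + m) ≤ c / 6 :=
      (Summable.sum_le_tsum (Finset.range j) (fun i _ => hnn (i + m))
        ((summable_nat_add_iff m).2 hs)).trans hm.le
    have h2 : ∑ i ∈ Finset.range j, b (m + i) ≤ Real.sqrt (4 * k + 2) *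
        ∑ i ∈ Finset.range j, (1 / Real.sqrt (4 * (i + m : ℕ) + 2)) * b (i + m) := by
      rw [Finset.mul_sum]
      refine Finset.sum_le_sum fun i hi => ?_
      have hi' : i + m ≤ k := by have := Finset.mem_range.1 hi; omega
      have hi'' : ((i + m : ℕ) : ℝ) ≤ k := by exact_mod_cast hi'
      rw [← mul_assoc, mul_one_div, add_comm m i]
      refine le_mul_of_one_le_left (hb _) ?_
      rw [one_le_div (by positivity)]
      gcongr
    exact h2.trans (by gcongr)
  have hsq : Real.sqrt (4 * k + 2) ≤ 3 * Real.sqrt k := by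
    rw [show (3 : ℝ) = Real.sqrt 9 by rw [show (9 : ℝ) = 3 ^ 2 by norm_num]; simp,
      ← Real.sqrt_mul (by norm_num)]
    apply Real.sqrt_le_sqrt
    linarith
  have h3 : c / 2 * Real.sqrt k ≤ S := by nlinarith
  have h4 : 2 * S / c < Real.sqrt k := by
    apply Real.lt_sqrt_of_sq_lt
    linarith
  rw [div_lt_iff₀ hc] at h4
  nlinarith

end Recurrence

/-! ### Recurrences for the Laguerre functions -/

/-- The function `z ↦ (d/dz)^k (z^k e^{-z})`. -/
def rodrigues (k : ℕ) (z : ℝ) : ℝ := iteratedDeriv k (fun t : ℝ => t ^ k * Real.exp (-t)) z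

theorem contDiff_pow_mul_exp_neg (k : ℕ) : ContDiff ℝ ∞ fun t : ℝ => t ^ k * Real.exp (-t) :=
  (contDiff_id.pow k).mul (Real.contDiff_exp.comp contDiff_neg)

theorem rodrigues_succ (k : ℕ) (z : ℝ) :
    rodrigues (k + 1) z = z * deriv (rodrigues k) z + (k + 1) * rodrigues k z := by
  have h := iteratedDeriv_id_mul (contDiff_pow_mul_exp_neg k) k z
  have e : (fun t : ℝ => t * (t ^ k * Real.exp (-t))) = fun t => t ^ (k + 1) * Real.exp (-t) := by
    funext t; ring
  rw [e, iteratedDeriv_succ (f := fun t : ℝ => t ^ k * Real.exp (-t))] at h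
  exact h

theorem deriv_rodrigues_succ (k : ℕ) (z : ℝ) :
    deriv (rodrigues (k + 1)) z = (k + 1) * deriv (rodrigues k) z - rodrigues (k + 1) z := by
  have h1 : deriv (fun t : ℝ => t ^ (k + 1) * Real.exp (-t)) =
      fun t => ((k : ℝ) + 1) * (t ^ k * Real.exp (-t)) - t ^ (k + 1) * Real.exp (-t) := by
    funext t
    have h2 : HasDerivAt (fun t : ℝ => Real.exp (-t)) (Real.exp (-t) * (-1)) t :=
      (hasDerivAt_neg t).exp
    have h3 := ((hasDerivAt_pow (k + 1) t).mul h2).deriv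
    refine Eq.trans h3 ?_
    rw [Nat.add_sub_cancel]
    push_cast
    ring
  have h4 : rodrigues (k + 1) =
      fun z => iteratedDeriv k (deriv (fun t : ℝ => t ^ (k + 1) * Real.exp (-t))) z := by
    funext z
    rw [rodrigues, iteratedDeriv_succ']
  have h5 : deriv (rodrigues (k + 1)) z =
      iteratedDeriv (k + 1) (deriv (fun t : ℝ => t ^ (k + 1) * Real.exp (-t))) z := by
    rw [iteratedDeriv_succ, h4]
  have h6 : iteratedDeriv (k + 1) (fun t => ((k : ℝ) + 1) * (t ^ k * Real.exp (-t)) -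
        t ^ (k + 1) * Real.exp (-t)) z =
      iteratedDeriv (k + 1) (fun t => ((k : ℝ) + 1) * (t ^ k * Real.exp (-t))) z -
        iteratedDeriv (k + 1) (fun t => t ^ (k + 1) * Real.exp (-t)) z :=
    iteratedDeriv_sub
      ((contDiff_const.mul (contDiff_pow_mul_exp_neg k)).of_le
        (by exact_mod_cast le_top)).contDiffAt
      ((contDiff_pow_mul_exp_neg (k + 1)).of_le (by exact_mod_cast le_top)).contDiffAt
  rw [h5, h1, h6, iteratedDeriv_const_mul_field, iteratedDeriv_succ]
  rfl

/-- The Laguerre differences `k (ℒ_k - ℒ_{k-1}) = z e^{z/2} (R_k' + R_k)`. -/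
def laguerreDiff (k : ℕ) (z : ℝ) : ℝ :=
  z * (Real.exp (z / 2) / (k.factorial : ℝ) * (deriv (rodrigues k) z + rodrigues k z))

theorem laguerreFun_eq (k : ℕ) (z : ℝ) :
    laguerreFun k z = Real.exp (z / 2) / (k.factorial : ℝ) * rodrigues k z := rfl

theorem laguerreDiff_succ (k : ℕ) (z : ℝ) :
    laguerreDiff (k + 1) z = laguerreDiff k z - z * laguerreFun k z := by
  rw [laguerreDiff, deriv_rodrigues_succ, laguerreDiff, laguerreFun_eq, Nat.factorial_succ]
  push_cast
  have : (k.factorial : ℝ) ≠ 0 := by positivity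
  field_simp
  ring

theorem laguerreFun_succ_sub (k : ℕ) (z : ℝ) :
    (k + 1) * (laguerreFun (k + 1) z - laguerreFun k z) = laguerreDiff (k + 1) z := by
  rw [laguerreFun_eq, laguerreFun_eq, laguerreDiff_succ, laguerreDiff, laguerreFun_eq,
    rodrigues_succ, Nat.factorial_succ]
  push_cast
  have : (k.factorial : ℝ) ≠ 0 := by positivity
  field_simp
  ring

theorem laguerreFun_zero (z : ℝ) : laguerreFun 0 z = Real.exp (-(z / 2)) := by
  simp only [laguerreFun, Nat.factorial_zero, Nat.cast_one, div_one, iteratedDeriv_zero, pow_zero,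
    one_mul]
  rw [← Real.exp_add]
  congr 1
  ring

theorem laguerreDiff_zero (z : ℝ) : laguerreDiff 0 z = 0 := by
  have h0 : rodrigues 0 = fun t => Real.exp (-t) := by
    funext t; simp [rodrigues]
  have h1 : deriv (fun t : ℝ => Real.exp (-t)) z = Real.exp (-z) * (-1) :=
    (hasDerivAt_neg z).exp.deriv
  rw [laguerreDiff, h0, h1]
  simp

theorem laguerreFun_three_term (k : ℕ) (z : ℝ) :
    (k + 2) * laguerreFun (k + 2) z =
      (2 * k + 3 - z) * laguerreFun (k + 1) z - (k + 1) * laguerreFun k z := by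
  have h1 := laguerreFun_succ_sub (k + 1) z
  have h2 := laguerreFun_succ_sub k z
  rw [laguerreDiff_succ, ← h2] at h1
  push_cast at h1
  linear_combination h1

theorem not_summable_laguerreFun_sq {z : ℝ} (hz : 0 < z) :
    ¬ Summable fun k : ℕ => (1 / Real.sqrt (4 * k + 2)) * laguerreFun k z ^ 2 := by
  intro hs
  -- The factor `e^{z/2}` gives the Laguerre polynomials, normalized by `L 0 = 1`; being independent
  -- of `k`, it does not affect summability.
  have hsum : ∃ c > 0, ∃ K : ℕ, ∀ k ≥ K, c * Real.sqrt k ≤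
      ∑ j ∈ Finset.range (k + 1), (Real.exp (z / 2) * laguerreFun j z) ^ 2 := by
    refine exists_sqrt_le_sum_sq (d := fun k => Real.exp (z / 2) * laguerreDiff k z) hz ?_ ?_ ?_ ?_
    · rw [laguerreFun_zero, ← Real.exp_add]; simp
    · simp [laguerreDiff_zero]
    · intro k; simp only [laguerreDiff_succ]; ring
    · intro k; simp only [← laguerreFun_succ_sub]; ring
  refine not_summable_of_sqrt_le (fun k => sq_nonneg _) hsum ?_
  refine (hs.mul_left (Real.exp (z / 2) ^ 2)).congr fun k => ?_
  ring

/-! ### Orthonormality of the eigenfunctions -/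

/-- Multiplication by `|x|²` on Schwartz functions. -/
def normSqCLM : 𝓢(Plane, ℂ) →L[ℂ] 𝓢(Plane, ℂ) :=
  SchwartzMap.smulLeftCLM ℂ fun x : Plane => ((‖x‖ ^ 2 : ℝ) : ℂ)

theorem normSqCLM_apply (φ : 𝓢(Plane, ℂ)) (x : Plane) :
    normSqCLM φ x = ((‖x‖ ^ 2 : ℝ) : ℂ) * φ x := by
  have hq : (fun x : Plane => ((‖x‖ ^ 2 : ℝ) : ℂ)).HasTemperateGrowth := by
    simpa using hasTemperateGrowth_poly_norm_sq Polynomial.X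
  rw [normSqCLM, SchwartzMap.smulLeftCLM_apply_apply hq, smul_eq_mul]

/-- The Hermite operator as a continuous linear map. -/
def hermiteCLM : 𝓢(Plane, ℂ) →L[ℂ] 𝓢(Plane, ℂ) :=
  -(LineDeriv.laplacianCLM ℂ Plane 𝓢(Plane, ℂ)) + normSqCLM

theorem hermiteCLM_apply (φ : 𝓢(Plane, ℂ)) : hermiteCLM φ = hermiteOp φ := by
  simp [hermiteCLM, hermiteOp, normSqCLM]

theorem distribution_smul_apply (c : ℂ) (u : 𝓢'(Plane, ℂ)) (φ : 𝓢(Plane, ℂ)) :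
    (c • u) φ = c * u φ := rfl

theorem distribution_sub_apply (u v : 𝓢'(Plane, ℂ)) (φ : 𝓢(Plane, ℂ)) :
    (u - v) φ = u φ - v φ := rfl

theorem coe_normSqCLM (φ ψ : 𝓢(Plane, ℂ)) :
    ((normSqCLM φ : 𝓢(Plane, ℂ)) : 𝓢'(Plane, ℂ)) ψ = (φ : 𝓢'(Plane, ℂ)) (normSqCLM ψ) := by
  rw [SchwartzMap.coe_apply, SchwartzMap.coe_apply]
  congr 1
  funext x
  rw [normSqCLM_apply, normSqCLM_apply, smul_eq_mul, smul_eq_mul]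
  ring

/-- Symmetry of `H` for the bilinear pairing, by integration by parts. It gives orthogonality for
distinct eigenvalues and lets powers of `H` pass to the test function. -/
theorem coe_hermiteCLM (φ ψ : 𝓢(Plane, ℂ)) :
    ((hermiteCLM φ : 𝓢(Plane, ℂ)) : 𝓢'(Plane, ℂ)) ψ = (φ : 𝓢'(Plane, ℂ)) (hermiteCLM ψ) := by
  have h : ((Δ φ : 𝓢(Plane, ℂ)) : 𝓢'(Plane, ℂ)) ψ = (φ : 𝓢'(Plane, ℂ)) (Δ ψ) := by
    rw [SchwartzMap.coe_apply, SchwartzMap.coe_apply]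
    exact SchwartzMap.integral_smul_laplacian_right_eq_left ψ φ
  have e : ∀ χ : 𝓢(Plane, ℂ), hermiteCLM χ = -(Δ χ) + normSqCLM χ := fun χ => by
    simp [hermiteCLM]
  rw [e, e, map_add, map_add, map_neg, map_neg, ← coe_normSqCLM]
  change -(((Δ φ : 𝓢(Plane, ℂ)) : 𝓢'(Plane, ℂ)) ψ) + _ = _
  rw [h]
  rfl

theorem hermiteCLM_eigenfun (k : ℕ) :
    hermiteCLM (eigenfun k) = ((4 * k + 2 : ℝ) : ℂ) • eigenfun k := by
  rw [hermiteCLM_apply, hermiteOp_eigenfun]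

theorem hermiteCLM_pow_coe_eigenfun (k N : ℕ) (φ : 𝓢(Plane, ℂ)) :
    (eigenfun k : 𝓢'(Plane, ℂ)) ((hermiteCLM ^ N) φ) =
      ((4 * k + 2 : ℝ) : ℂ) ^ N * (eigenfun k : 𝓢'(Plane, ℂ)) φ := by
  induction N with
  | zero => simp
  | succ N ih =>
    rw [pow_succ', mul_apply_eq_comp, ← coe_hermiteCLM, hermiteCLM_eigenfun, map_smul,
      distribution_smul_apply, ih]
    ring

theorem coe_eigenfun_of_ne {j k : ℕ} (h : j ≠ k) :
    (eigenfun j : 𝓢'(Plane, ℂ)) (eigenfun k) = 0 := by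
  have h1 := coe_hermiteCLM (eigenfun j) (eigenfun k)
  rw [hermiteCLM_eigenfun, hermiteCLM_eigenfun, map_smul, map_smul, distribution_smul_apply,
    smul_eq_mul] at h1
  have h2 : (((4 * j + 2 : ℝ) : ℂ) - ((4 * k + 2 : ℝ) : ℂ)) *
      (eigenfun j : 𝓢'(Plane, ℂ)) (eigenfun k) = 0 := by
    rw [sub_mul, h1, sub_self]
  refine (mul_eq_zero.1 h2).resolve_left fun h3 => h ?_
  rw [sub_eq_zero, Complex.ofReal_inj] at h3
  have : (j : ℝ) = k := by linarith
  exact_mod_cast this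

theorem eigenfun_apply (k : ℕ) (x : Plane) :
    eigenfun k x = (((1 / Real.sqrt Real.pi) * laguerreFun k (‖x‖ ^ 2) : ℝ) : ℂ) := rfl

theorem normSqCLM_eigenfun_zero : normSqCLM (eigenfun 0) = eigenfun 0 - eigenfun 1 := by
  ext x
  have h := laguerreFun_succ_sub 0 (‖x‖ ^ 2)
  rw [laguerreDiff_succ, laguerreDiff_zero] at h
  rw [normSqCLM_apply, sub_apply, eigenfun_apply, eigenfun_apply, ← Complex.ofReal_mul,
    ← Complex.ofReal_sub]
  congr 1
  simp only [Nat.cast_zero, zero_add, one_mul, zero_sub] at h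
  linear_combination (1 / Real.sqrt Real.pi) * h

theorem normSqCLM_eigenfun_succ (k : ℕ) : normSqCLM (eigenfun (k + 1)) =
    ((2 * k + 3 : ℝ) : ℂ) • eigenfun (k + 1) - ((k + 1 : ℝ) : ℂ) • eigenfun k -
      ((k + 2 : ℝ) : ℂ) • eigenfun (k + 2) := by
  ext x
  have h := laguerreFun_three_term k (‖x‖ ^ 2)
  simp only [normSqCLM_apply, sub_apply, smul_apply, eigenfun_apply, smul_eq_mul,
    ← Complex.ofReal_mul, ← Complex.ofReal_sub]
  congr 1
  linear_combination (1 / Real.sqrt Real.pi) * h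

theorem coe_eigenfun_zero_self : (eigenfun 0 : 𝓢'(Plane, ℂ)) (eigenfun 0) = 1 := by
  rw [SchwartzMap.coe_apply]
  have h : ∀ x : Plane, eigenfun 0 x • eigenfun 0 x =
      (((1 / Real.pi) * Real.exp (-1 * ‖x‖ ^ 2) : ℝ) : ℂ) := by
    intro x
    rw [eigenfun_apply, laguerreFun_zero, smul_eq_mul, ← Complex.ofReal_mul]
    congr 1
    have h1 : Real.exp (-(‖x‖ ^ 2 / 2)) * Real.exp (-(‖x‖ ^ 2 / 2)) =
        Real.exp (-1 * ‖x‖ ^ 2) := by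
      rw [← Real.exp_add]; congr 1; ring
    have h2 : (1 / Real.sqrt Real.pi) * (1 / Real.sqrt Real.pi) = 1 / Real.pi := by
      rw [div_mul_div_comm, Real.mul_self_sqrt Real.pi_pos.le, one_mul]
    rw [← h1, ← h2]
    ring
  simp only [h]
  rw [integral_complex_ofReal, integral_const_mul,
    GaussianFourier.integral_rexp_neg_mul_sq_norm one_pos]
  simp [Real.pi_ne_zero]

/-- Multiplication by `|x|²` is symmetric. Expanding its matrix entry between consecutive
eigenfunctions in the two possible ways, by the three-term recurrence and orthogonality, shows that
they have equal norm. Only the Gaussian integral for `e_0` has to be computed. -/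
theorem coe_eigenfun_self (k : ℕ) : (eigenfun k : 𝓢'(Plane, ℂ)) (eigenfun k) = 1 := by
  induction k with
  | zero => exact coe_eigenfun_zero_self
  | succ k ih =>
    rcases k with _ | k
    · have h1 := coe_normSqCLM (eigenfun 0) (eigenfun 1)
      have h2 := normSqCLM_eigenfun_succ 0
      norm_num at h2
      rw [normSqCLM_eigenfun_zero, h2, map_sub, map_sub, map_sub, map_smul, map_smul,
        coe_eigenfun_of_ne (j := 0) (k := 1) (by norm_num),
        coe_eigenfun_of_ne (j := 0) (k := 2) (by norm_num), ih,
        distribution_sub_apply] at h1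
      rw [coe_eigenfun_of_ne (j := 0) (k := 1) (by norm_num)] at h1
      simpa using h1
    · have h1 := coe_normSqCLM (eigenfun (k + 1)) (eigenfun (k + 2))
      have h2 := normSqCLM_eigenfun_succ (k + 1)
      rw [normSqCLM_eigenfun_succ, h2] at h1
      simp only [map_sub, map_smul, distribution_sub_apply, distribution_smul_apply] at h1
      rw [coe_eigenfun_of_ne (j := k + 1) (k := k + 1 + 1) (by omega),
        coe_eigenfun_of_ne (j := k + 1) (k := k + 1 + 2) (by omega), ih,
        coe_eigenfun_of_ne (j := k) (k := k + 2) (by omega)] at h1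
      have hk : ((k + 2 : ℝ) : ℂ) ≠ 0 := by
        rw [Complex.ofReal_ne_zero]; positivity
      have h3 : ((k + 2 : ℝ) : ℂ) * (eigenfun (k + 2) : 𝓢'(Plane, ℂ)) (eigenfun (k + 2)) =
          ((k + 2 : ℝ) : ℂ) * 1 := by
        simp only [smul_eq_mul] at h1
        push_cast at h1 ⊢
        linear_combination -h1
      exact mul_left_cancel₀ hk h3

/-! ### Convergence of eigenfunction expansions in the space of tempered distributions -/

/-- The conjugation in the inner product is harmless because `e_k` is real valued. -/
theorem inner_toLp_eigenfun (k : ℕ) (φ : 𝓢(Plane, ℂ)) :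
    inner ℂ ((eigenfun k).toLp 2) (φ.toLp 2) = (eigenfun k : 𝓢'(Plane, ℂ)) φ := by
  refine (SchwartzMap.inner_toL2_toL2_eq (eigenfun k) φ volume).trans ?_
  rw [SchwartzMap.coe_apply]
  congr 1
  funext x
  rw [eigenfun_apply]
  simp

theorem norm_toLp_eigenfun (k : ℕ) : ‖(eigenfun k).toLp 2‖ = 1 := by
  have h := inner_toLp_eigenfun k (eigenfun k)
  rw [coe_eigenfun_self, inner_self_eq_norm_sq_to_K] at h
  have h2 : ‖(eigenfun k).toLp 2‖ ^ 2 = 1 := Complex.ofReal_injective (by simpa using h)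
  exact (pow_eq_one_iff_of_nonneg (norm_nonneg _) two_ne_zero).1 h2

/-- The coefficient functional `u ↦ ⟨e_k, u⟩` on `L²`. -/
def coeffL2 (k : ℕ) : Lp ℂ 2 (volume : Measure Plane) →L[ℂ] ℂ :=
  innerSL ℂ ((eigenfun k).toLp 2)

theorem norm_coeffL2 (k : ℕ) : ‖coeffL2 k‖ = 1 := by
  rw [coeffL2, innerSL_apply_norm, norm_toLp_eigenfun]

theorem coeffL2_toLp_hermiteCLM_pow (k N : ℕ) (φ : 𝓢(Plane, ℂ)) :
    coeffL2 k (((hermiteCLM ^ N) φ).toLp 2) =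
      ((4 * k + 2 : ℝ) : ℂ) ^ N * (eigenfun k : 𝓢'(Plane, ℂ)) φ := by
  rw [← hermiteCLM_pow_coe_eigenfun, ← inner_toLp_eigenfun]
  rfl

theorem hasSum_of_forall_hasSum {ι : Type*} {u : ι → 𝓢'(Plane, ℂ)} {v : 𝓢'(Plane, ℂ)}
    (h : ∀ φ, HasSum (fun k => u k φ) (v φ)) : HasSum u v := by
  rw [HasSum, PointwiseConvergenceCLM.tendsto_iff_forall_tendsto]
  intro φ
  refine Filter.Tendsto.congr (fun s => ?_) (h φ)
  symm
  exact map_sum (PointwiseConvergenceCLM.evalCLM (RingHom.id ℂ) ℂ φ) _ _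

/-- The distribution `φ ↦ A (H^N φ)` for a bounded functional `A` on `L²`. -/
def hermiteDual (N : ℕ) (A : Lp ℂ 2 (volume : Measure Plane) →L[ℂ] ℂ) : 𝓢'(Plane, ℂ) :=
  ContinuousLinearMap.toPointwiseConvergenceCLM _ _ _ _
    (A ∘L (SchwartzMap.toLpCLM ℂ ℂ 2 (volume : Measure Plane)) ∘L (hermiteCLM ^ N))

theorem hermiteDual_apply (N : ℕ) (A : Lp ℂ 2 (volume : Measure Plane) →L[ℂ] ℂ)
    (φ : 𝓢(Plane, ℂ)) : hermiteDual N A φ = A (((hermiteCLM ^ N) φ).toLp 2) := rfl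

theorem hasSum_clm_apply {E ι : Type*} [NormedAddCommGroup E] [NormedSpace ℂ E]
    {u : ι → E →L[ℂ] ℂ} {A : E →L[ℂ] ℂ} (h : HasSum u A) (x : E) :
    HasSum (fun i => u i x) (A x) :=
  h.mapL (ContinuousLinearMap.apply ℂ ℂ x)

/-- Pairing `φ` with `e_k` is `(4k+2)^{-N}` times pairing `H^N φ` with `e_k`. Polynomial growth of
the coefficients is thereby traded for regularity of `φ`, and the series is summed in the dual of
`L²`. -/
theorem hasSum_smul_eigenfun {c : ℕ → ℂ} {N : ℕ} {A : Lp ℂ 2 (volume : Measure Plane) →L[ℂ] ℂ}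
    (hA : HasSum (fun k : ℕ => (c k * (((4 * k + 2 : ℝ) : ℂ) ^ N)⁻¹) • coeffL2 k) A) :
    HasSum (fun k => c k • (eigenfun k : 𝓢'(Plane, ℂ))) (hermiteDual N A) := by
  refine hasSum_of_forall_hasSum fun φ => ?_
  have h1 := hasSum_clm_apply hA (((hermiteCLM ^ N) φ).toLp 2)
  have h2 : ∀ k : ℕ, (c k • (eigenfun k : 𝓢'(Plane, ℂ))) φ =
      (c k * (((4 * k + 2 : ℝ) : ℂ) ^ N)⁻¹) * coeffL2 k (((hermiteCLM ^ N) φ).toLp 2) := by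
    intro k
    have hk : ((4 * k + 2 : ℝ) : ℂ) ≠ 0 := by rw [Complex.ofReal_ne_zero]; positivity
    rw [distribution_smul_apply, coeffL2_toLp_hermiteCLM_pow]
    field_simp
  rw [funext h2, hermiteDual_apply]
  exact h1

theorem summable_smul_eigenfun {c : ℕ → ℂ} {N : ℕ}
    (hc : Summable fun k : ℕ => ‖c k‖ * ((4 * k + 2 : ℝ) ^ N)⁻¹) :
    Summable fun k => c k • (eigenfun k : 𝓢'(Plane, ℂ)) := by
  have hs : Summable fun k : ℕ => (c k * (((4 * k + 2 : ℝ) : ℂ) ^ N)⁻¹) • coeffL2 k := by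
    refine Summable.of_norm (hc.congr fun k => ?_)
    rw [norm_smul, norm_coeffL2, mul_one, norm_mul, norm_inv,
      norm_pow, Complex.norm_real, Real.norm_of_nonneg (by positivity)]
  exact (hasSum_smul_eigenfun hs.hasSum).summable

theorem hasSum_apply {ι : Type*} {u : ι → 𝓢'(Plane, ℂ)} (hu : Summable u) (φ : 𝓢(Plane, ℂ)) :
    HasSum (fun k => u k φ) ((∑' k, u k) φ) :=
  hu.hasSum.mapL (PointwiseConvergenceCLM.evalCLM (RingHom.id ℂ) ℂ φ)

theorem tsum_smul_eigenfun_apply_eigenfun {c : ℕ → ℂ}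
    (hc : Summable fun k => c k • (eigenfun k : 𝓢'(Plane, ℂ))) (j : ℕ) :
    (∑' k, c k • (eigenfun k : 𝓢'(Plane, ℂ))) (eigenfun j) = c j := by
  refine (hasSum_apply hc (eigenfun j)).unique ?_
  have h : c j = (c j • (eigenfun j : 𝓢'(Plane, ℂ))) (eigenfun j) := by
    rw [distribution_smul_apply, coe_eigenfun_self, mul_one]
  rw [h]
  refine hasSum_single j fun k hk => ?_
  rw [distribution_smul_apply, coe_eigenfun_of_ne hk, mul_zero]

/-! ### Complex Gaussian variables -/

/-- The planar density is the product of two centred Gaussian densities of variance `1/2`; the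
imaginary part integrates to one. -/
theorem hasLaw_re_stdComplexGaussian :
    HasLaw Complex.re (gaussianReal 0 (1 / 2)) stdComplexGaussian where
  aemeasurable := Complex.measurable_re.aemeasurable
  map_eq := by
    have hv : (1 / 2 : NNReal) ≠ 0 := by norm_num
    have hpdf : ∀ p : ℝ × ℝ, ENNReal.ofReal (1 / Real.pi *
        Real.exp (-‖Complex.measurableEquivRealProd.symm p‖ ^ 2)) =
        gaussianPDF 0 (1 / 2) p.1 * gaussianPDF 0 (1 / 2) p.2 := by
      intro p
      rw [gaussianPDF, gaussianPDF, ← ENNReal.ofReal_mul (gaussianPDFReal_nonneg _ _ _)]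
      congr 1
      rw [gaussianPDFReal, gaussianPDFReal, Complex.sq_norm, Complex.normSq_apply,
        Complex.measurableEquivRealProd_symm_apply]
      have h1 : Real.sqrt (2 * Real.pi * ((1 / 2 : NNReal) : ℝ)) = Real.sqrt Real.pi := by
        congr 1; push_cast; ring
      have h2 : (1 / Real.pi : ℝ) = (Real.sqrt Real.pi)⁻¹ * (Real.sqrt Real.pi)⁻¹ := by
        rw [← mul_inv, Real.mul_self_sqrt Real.pi_pos.le, one_div]
      have h3 : Real.exp (-(p.1 * p.1 + p.2 * p.2)) =
          Real.exp (-(p.1 - 0) ^ 2 / (2 * ((1 / 2 : NNReal) : ℝ))) *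
            Real.exp (-(p.2 - 0) ^ 2 / (2 * ((1 / 2 : NNReal) : ℝ))) := by
        rw [← Real.exp_add]; congr 1; push_cast; ring
      rw [h1, h2, h3]
      ring
    ext s hs
    rw [Measure.map_apply Complex.measurable_re hs, stdComplexGaussian,
      withDensity_apply _ (Complex.measurable_re hs),
      ← lintegral_indicator (Complex.measurable_re hs),
      ← (Complex.volume_preserving_equiv_real_prod.symm _).lintegral_comp_emb
        (MeasurableEquiv.measurableEmbedding _), gaussianReal_apply _ hv,
      ← lintegral_indicator hs]
    have h4 : ∀ p : ℝ × ℝ, (Complex.re ⁻¹' s).indicator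
        (fun z : ℂ => ENNReal.ofReal (1 / Real.pi * Real.exp (-‖z‖ ^ 2)))
          (Complex.measurableEquivRealProd.symm p) =
        s.indicator (gaussianPDF 0 (1 / 2)) p.1 * gaussianPDF 0 (1 / 2) p.2 := by
      intro p
      by_cases hp : p.1 ∈ s
      · rw [Set.indicator_of_mem hp, ← hpdf, Set.indicator_of_mem]
        exact hp
      · rw [Set.indicator_of_notMem hp, zero_mul, Set.indicator_of_notMem]
        exact hp
    simp only [h4]
    rw [Measure.volume_eq_prod, lintegral_prod_mul
      ((measurable_gaussianPDF _ _).indicator hs).aemeasurable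
      (measurable_gaussianPDF _ _).aemeasurable, lintegral_gaussianPDF_eq_one _ hv, mul_one]

theorem lintegral_enorm_stdComplexGaussian_ne_top :
    ∫⁻ z, ‖z‖ₑ ∂stdComplexGaussian ≠ ⊤ := by
  have hint : Integrable fun z : ℂ => ‖z‖ ^ (1 : ℝ) * Real.exp (-‖z‖ ^ (2 : ℝ)) := by
    -- The integral of a nonintegrable function is zero by convention, whereas the Gamma function
    -- formula gives a positive value.
    refine Integrable.of_integral_ne_zero ?_
    rw [Complex.integral_rpow_mul_exp_neg_rpow (by norm_num) (by norm_num)]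
    have := Real.Gamma_pos_of_pos (show (0 : ℝ) < (1 + 2) / 2 by norm_num)
    positivity
  have hint2 := (hint.const_mul (1 / Real.pi)).lintegral_lt_top.ne
  rw [stdComplexGaussian, lintegral_withDensity_eq_lintegral_mul₀ (by fun_prop) (by fun_prop)]
  refine (lintegral_congr fun z => ?_).trans_ne hint2
  rw [Pi.mul_apply, ← ofReal_norm, ← ENNReal.ofReal_mul (by positivity)]
  congr 1
  norm_num
  ring

/-- Anti-concentration of a centred Gaussian variable. -/
theorem gaussianReal_abs_lt_le (v : NNReal) {M : ℝ} (hM : 0 ≤ M) :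
    gaussianReal 0 v {x | |x| < M} ≤ ENNReal.ofReal ((2 + 2 * M) / Real.sqrt (1 + v)) := by
  have hs0 : 0 < Real.sqrt (1 + v) := Real.sqrt_pos.2 (by positivity)
  -- For `v < 1`, including the degenerate `v = 0`, the summand `2` in the numerator makes the bound
  -- at least one. For `v ≥ 1` the density is at most `1/√(2πv) ≤ 1/√(1+v)`.
  rcases lt_or_ge (v : ℝ) 1 with hv | hv
  · refine prob_le_one.trans ?_
    rw [← ENNReal.ofReal_one]
    apply ENNReal.ofReal_le_ofReal
    rw [one_le_div hs0]
    have : Real.sqrt (1 + v) ≤ 2 := by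
      rw [Real.sqrt_le_left (by norm_num)]; linarith
    linarith
  · have hv0 : v ≠ 0 := by
      rintro rfl; norm_num at hv
    have hset : {x : ℝ | |x| < M} = Set.Ioo (-M) M := by
      ext x; simp [abs_lt]
    rw [gaussianReal_apply _ hv0, hset]
    calc ∫⁻ x in Set.Ioo (-M) M, gaussianPDF 0 v x
        ≤ ∫⁻ _ in Set.Ioo (-M) M, ENNReal.ofReal (1 / Real.sqrt (1 + v)) := by
          refine lintegral_mono fun x => ?_
          rw [gaussianPDF]
          apply ENNReal.ofReal_le_ofReal
          rw [gaussianPDFReal, one_div]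
          refine (mul_le_of_le_one_right (by positivity) (Real.exp_le_one_iff.2 ?_)).trans ?_
          · rw [neg_div]
            have : 0 ≤ (x - 0) ^ 2 / (2 * (v : ℝ)) := by positivity
            linarith
          · have : (1 + v : ℝ) ≤ 2 * Real.pi * v := by
              nlinarith [Real.pi_gt_three]
            gcongr
      _ = ENNReal.ofReal (2 * M / Real.sqrt (1 + v)) := by
          rw [setLIntegral_const, Real.volume_Ioo, ← ENNReal.ofReal_mul (by positivity)]
          congr 1
          ring
      _ ≤ _ := by
          apply ENNReal.ofReal_le_ofReal
          gcongr
          linarith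

/-! ### Sums of independent Gaussian variables -/

section RandomSum

variable {Ω : Type*} [MeasurableSpace Ω] {P : Measure Ω} {g : ℕ → Ω → ℂ}

theorem hasLaw_sum_re [IsProbabilityMeasure P]
    (hlaw : ∀ k, HasLaw (g k) stdComplexGaussian P) (hindep : iIndepFun g P)
    (b : ℕ → ℝ) (m : ℕ) :
    HasLaw (fun w => ∑ k ∈ Finset.range m, b k * (g k w).re)
      (gaussianReal 0 (∑ k ∈ Finset.range m, .mk (b k ^ 2) (sq_nonneg _) * (1 / 2))) P := by
  have hX : ∀ k, HasLaw (fun w => b k * (g k w).re)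
      (gaussianReal 0 (.mk (b k ^ 2) (sq_nonneg _) * (1 / 2))) P := fun k => by
    simpa using gaussianReal_const_mul (hasLaw_re_stdComplexGaussian.fun_comp (hlaw k)) (b k)
  have hind : iIndepFun (fun k w => b k * (g k w).re) P :=
    hindep.comp (fun k z => b k * z.re) fun k => by fun_prop
  induction m with
  | zero =>
    refine ⟨by fun_prop, ?_⟩
    simp
  | succ m ih =>
    have h1 : (fun w => ∑ k ∈ Finset.range (m + 1), b k * (g k w).re) =
        (fun w => ∑ k ∈ Finset.range m, b k * (g k w).re) + fun w => b m * (g m w).re := by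
      funext w; simp [Finset.sum_range_succ]
    have h2 : IndepFun (fun w => ∑ k ∈ Finset.range m, b k * (g k w).re)
        (fun w => b m * (g m w).re) P := by
      have := hind.indepFun_finsetSum_of_notMem₀ (fun k => (hX k).aemeasurable)
        (Finset.notMem_range_self (n := m))
      convert this using 1
      funext w
      simp
    rw [h1, Finset.sum_range_succ]
    refine ⟨ih.aemeasurable.add (hX m).aemeasurable, ?_⟩
    have := gaussianReal_add_gaussianReal_of_indepFun h2 ih.map_eq (hX m).map_eq
    rwa [add_zero] at this

theorem measure_abs_sum_re_lt_le [IsProbabilityMeasure P]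
    (hlaw : ∀ k, HasLaw (g k) stdComplexGaussian P)
    (hindep : iIndepFun g P) (b : ℕ → ℝ) (m : ℕ) {M : ℝ} (hM : 0 ≤ M) :
    P {w | |∑ k ∈ Finset.range m, b k * (g k w).re| < M} ≤
      ENNReal.ofReal ((2 + 2 * M) / Real.sqrt (1 + ∑ k ∈ Finset.range m, b k ^ 2 / 2)) := by
  have h := hasLaw_sum_re hlaw hindep b m
  have hmeas : MeasurableSet {x : ℝ | |x| < M} := measurableSet_lt (by fun_prop) (by fun_prop)
  rw [h.measure_eq (p := fun x => |x| < M) hmeas]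
  refine (gaussianReal_abs_lt_le _ hM).trans_eq ?_
  congr 4
  rw [NNReal.coe_sum]
  refine Finset.sum_congr rfl fun k _ => ?_
  rw [mul_one_div]
  rfl

/-- By Tonelli the expectation of the sum is the common first absolute moment times a convergent
series. -/
theorem ae_summable_norm_gaussian (hlaw : ∀ k, HasLaw (g k) stdComplexGaussian P) :
    ∀ᵐ w ∂P, Summable fun k : ℕ => ‖g k w‖ * ((4 * k + 2 : ℝ) ^ 2)⁻¹ := by
  set C := ∫⁻ z, ‖z‖ₑ ∂stdComplexGaussian
  have hsum : Summable fun k : ℕ => ((4 * k + 2 : ℝ) ^ 2)⁻¹ := by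
    have h1 : Summable fun k : ℕ => (((k : ℝ) + 1) ^ 2)⁻¹ := by
      have := (summable_nat_add_iff 1).2 (Real.summable_nat_pow_inv.2 one_lt_two)
      simpa using this
    refine Summable.of_nonneg_of_le (fun k => by positivity) (fun k => ?_) h1
    have : (0 : ℝ) ≤ k := by positivity
    gcongr <;> linarith
  have hfin : ∫⁻ w, ∑' k : ℕ, ‖g k w‖ₑ * ENNReal.ofReal ((4 * k + 2 : ℝ) ^ 2)⁻¹ ∂P ≠ ⊤ := by
    rw [lintegral_tsum fun k => ((hlaw k).aemeasurable.enorm.mul_const _)]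
    have h2 : ∀ k : ℕ, ∫⁻ w, ‖g k w‖ₑ * ENNReal.ofReal ((4 * k + 2 : ℝ) ^ 2)⁻¹ ∂P =
        C * ENNReal.ofReal ((4 * k + 2 : ℝ) ^ 2)⁻¹ := by
      intro k
      rw [lintegral_mul_const'' _ (hlaw k).aemeasurable.enorm]
      congr 1
      exact (hlaw k).lintegral_comp (f := fun z => ‖z‖ₑ) (by fun_prop)
    simp only [h2]
    rw [ENNReal.tsum_mul_left]
    exact ENNReal.mul_ne_top lintegral_enorm_stdComplexGaussian_ne_top hsum.tsum_ofReal_ne_top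
  have hmeas : AEMeasurable
      (fun w => ∑' k : ℕ, ‖g k w‖ₑ * ENNReal.ofReal ((4 * k + 2 : ℝ) ^ 2)⁻¹) P :=
    AEMeasurable.tsum fun k => (hlaw k).aemeasurable.enorm.mul_const _
  filter_upwards [ae_lt_top' hmeas hfin] with w hw
  refine (ENNReal.summable_toReal hw.ne).congr fun k => ?_
  rw [ENNReal.toReal_mul, toReal_enorm, ENNReal.toReal_ofReal (by positivity)]

end RandomSum

/-! ### Random fields with diverging variance -/

section SmallBall

open Filter Topology

/-- The indicator function of `|t| < M`. -/
def smallIndicator (M : ℝ) : ℝ → ENNReal := Set.indicator {t | |t| < M} 1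

theorem measurableSet_abs_lt (M : ℝ) : MeasurableSet {t : ℝ | |t| < M} :=
  measurableSet_lt (by fun_prop) (by fun_prop)

theorem measurable_smallIndicator (M : ℝ) : Measurable (smallIndicator M) :=
  measurable_one.indicator (measurableSet_abs_lt M)

theorem aemeasurable_liminf {α : Type*} [MeasurableSpace α] {μ : Measure α}
    {f : ℕ → α → ENNReal} (hf : ∀ n, AEMeasurable (f n) μ) :
    AEMeasurable (fun x => liminf (fun n => f n x) atTop) μ := by
  refine ⟨fun x => liminf (fun n => (hf n).mk (f n) x) atTop,
    .liminf fun n => (hf n).measurable_mk, ?_⟩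
  filter_upwards [ae_all_iff.2 fun n => (hf n).ae_eq_mk] with x hx
  simp only [hx]

/-- The indicator of an open set is lower semicontinuous; this is why `|t| < M` is strict. -/
theorem smallIndicator_le_liminf (M : ℝ) {u : ℕ → ℝ} {t : ℝ} (hu : Tendsto u atTop (𝓝 t)) :
    smallIndicator M t ≤ liminf (fun m => smallIndicator M (u m)) atTop := by
  by_cases ht : |t| < M
  · have h1 : ∀ᶠ m in atTop, smallIndicator M t ≤ smallIndicator M (u m) := by
      filter_upwards [(tendsto_order.1 hu.abs).2 M ht] with m hm
      rw [smallIndicator, Set.indicator_of_mem (by exact ht), Set.indicator_of_mem (by exact hm)]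
      simp
    exact le_liminf_of_le (by isBoundedDefault) h1
  · rw [smallIndicator, Set.indicator_of_notMem (by exact ht)]
    exact zero_le

theorem lintegral_smallIndicator {α : Type*} [MeasurableSpace α] {μ : Measure α} {f : α → ℝ}
    (hf : AEMeasurable f μ) (M : ℝ) : ∫⁻ x, smallIndicator M (f x) ∂μ = μ {x | |f x| < M} := by
  have h := lintegral_indicator_one₀ (hf.nullMeasurableSet_preimage (measurableSet_abs_lt M))
  rw [← Set.preimage_ofPred_eq (p := fun t : ℝ => |t| < M) (f := f), ← h]
  rfl

/-- An upper bound for the probability that a Gaussian variable of variance `V` is at most `M`. -/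
def smallBallBound (M V : ℝ) : ENNReal := ENNReal.ofReal ((2 + 2 * M) / Real.sqrt (1 + V))

theorem continuousOn_smallBallBound (M : ℝ) : ContinuousOn (smallBallBound M) (Set.Ici 0) := by
  refine ENNReal.continuous_ofReal.comp_continuousOn (continuousOn_const.div (by fun_prop) ?_)
  intro V hV
  have : 0 ≤ V := hV
  positivity

theorem measurable_smallBallBound (M : ℝ) : Measurable (smallBallBound M) := by
  unfold smallBallBound
  fun_prop

theorem smallBallBound_anti {M V W : ℝ} (hM : 0 ≤ M) (hV : 0 ≤ V) (hVW : V ≤ W) :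
    smallBallBound M W ≤ smallBallBound M V := by
  unfold smallBallBound
  gcongr

theorem smallBallBound_le {M V : ℝ} (hM : 0 ≤ M) (hV : 0 ≤ V) :
    smallBallBound M V ≤ ENNReal.ofReal (2 + 2 * M) := by
  refine (smallBallBound_anti hM le_rfl hV).trans_eq ?_
  simp [smallBallBound]

theorem tendsto_smallBallBound_atTop (M : ℝ) : Tendsto (smallBallBound M) atTop (𝓝 0) := by
  have h : Tendsto (fun V : ℝ => (2 + 2 * M) / Real.sqrt (1 + V)) atTop (𝓝 0) :=
    tendsto_const_nhds.div_atTop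
      (Real.tendsto_sqrt_atTop.comp (tendsto_atTop_add_const_left _ _ tendsto_id))
  have h2 := ENNReal.tendsto_ofReal h
  rwa [ENNReal.ofReal_zero] at h2

variable {X : Type*} [MeasurableSpace X] {μ : Measure X} [IsFiniteMeasure μ]
  {p : ℕ → ℕ → X → ℝ} {q : ℕ → X → ℝ}

theorem tendsto_sum_sq_atTop {u : ℕ → ℝ} (hu : ¬ Summable fun k => u k ^ 2) :
    Tendsto (fun m => ∑ k ∈ Finset.range m, u k ^ 2 / 2) atTop atTop := by
  refine (not_summable_iff_tendsto_nat_atTop_of_nonneg fun k => by positivity).1 fun h => hu ?_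
  refine (h.mul_left 2).congr fun k => ?_
  ring

/-- The bound decreases as terms are added, so for every fixed `N` the inner lower limit is at most
the value at `m = N`. Dominated convergence then applies twice: `n → ∞` replaces `p` by `q`, and `N
→ ∞` uses the divergence of the variance. -/
theorem liminf_liminf_lintegral_smallBallBound (hp : ∀ n k, Measurable (p n k))
    (hlim : ∀ k x, Tendsto (fun n => p n k x) atTop (𝓝 (q k x)))
    (hdiv : ∀ᵐ x ∂μ, ¬ Summable fun k => q k x ^ 2) {M : ℝ} (hM : 0 ≤ M) :
    liminf (fun n => liminf (fun m =>
      ∫⁻ x, smallBallBound M (∑ k ∈ Finset.range m, p n k x ^ 2 / 2) ∂μ) atTop) atTop = 0 := by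
  have hq : ∀ k, Measurable (q k) := fun k =>
    measurable_of_tendsto_metrizable (fun n => hp n k) (tendsto_pi_nhds.2 (hlim k))
  have hnn : ∀ (u : ℕ → ℝ) (m : ℕ), 0 ≤ ∑ k ∈ Finset.range m, u k ^ 2 / 2 := fun u m =>
    Finset.sum_nonneg fun k _ => by positivity
  have hconst : ∫⁻ _, ENNReal.ofReal (2 + 2 * M) ∂μ ≠ ⊤ := by
    rw [lintegral_const]
    exact ENNReal.mul_ne_top ENNReal.ofReal_ne_top (measure_ne_top _ _)
  have h1 : ∀ N, Tendsto (fun n =>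
      ∫⁻ x, smallBallBound M (∑ k ∈ Finset.range N, p n k x ^ 2 / 2) ∂μ) atTop
      (𝓝 (∫⁻ x, smallBallBound M (∑ k ∈ Finset.range N, q k x ^ 2 / 2) ∂μ)) := by
    intro N
    refine tendsto_lintegral_of_dominated_convergence (fun _ => ENNReal.ofReal (2 + 2 * M))
      (fun n => (measurable_smallBallBound M).comp (by fun_prop))
      (fun n => ae_of_all _ fun x => smallBallBound_le hM (hnn _ _)) hconst
      (ae_of_all _ fun x => ?_)
    refine ((continuousOn_smallBallBound M) _ (hnn (fun k => q k x) N)).tendsto.comp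
      (tendsto_nhdsWithin_iff.2 ⟨?_, Eventually.of_forall fun n => hnn (fun k => p n k x) N⟩)
    exact tendsto_finsetSum _ fun k _ => ((hlim k x).pow 2).div_const 2
  have h2 : Tendsto (fun N =>
      ∫⁻ x, smallBallBound M (∑ k ∈ Finset.range N, q k x ^ 2 / 2) ∂μ) atTop (𝓝 0) := by
    rw [← lintegral_zero (μ := μ)]
    refine tendsto_lintegral_of_dominated_convergence (fun _ => ENNReal.ofReal (2 + 2 * M))
      (fun n => (measurable_smallBallBound M).comp (by fun_prop))
      (fun n => ae_of_all _ fun x => smallBallBound_le hM (hnn _ _)) hconst ?_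
    filter_upwards [hdiv] with x hx
    exact (tendsto_smallBallBound_atTop M).comp (tendsto_sum_sq_atTop hx)
  refine le_antisymm (ge_of_tendsto' h2 fun N => ?_) zero_le
  rw [← (h1 N).liminf_eq]
  refine liminf_le_liminf (Eventually.of_forall fun n => ?_)
  refine liminf_le_of_frequently_le' (Eventually.frequently ?_)
  filter_upwards [eventually_ge_atTop N] with m hm
  refine lintegral_mono fun x => smallBallBound_anti hM (hnn _ _) ?_
  exact Finset.sum_le_sum_of_subset_of_nonneg (Finset.range_mono hm) fun k _ _ => by positivity

variable {Ω : Type*} [MeasurableSpace Ω] {P : Measure Ω} [IsProbabilityMeasure P] {g : ℕ → Ω → ℂ}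

/-- If the variances of Gaussian random fields diverge, then the fields are almost surely large
on most of the space, along a subsequence. -/
theorem ae_liminf_measure_abs_lt_eq_zero (hlaw : ∀ k, HasLaw (g k) stdComplexGaussian P)
    (hindep : iIndepFun g P) (hp : ∀ n k, Measurable (p n k))
    (hlim : ∀ k x, Tendsto (fun n => p n k x) atTop (𝓝 (q k x)))
    (hdiv : ∀ᵐ x ∂μ, ¬ Summable fun k => q k x ^ 2) {M : ℝ} (hM : 0 ≤ M) :
    ∀ᵐ w ∂P, ∀ F : ℕ → X → ℝ, (∀ n x, HasSum (fun k => p n k x * (g k w).re) (F n x)) →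
      liminf (fun n => μ {x | |F n x| < M}) atTop = 0 := by
  set S : ℕ → ℕ → Ω → X → ℝ := fun n m w x => ∑ k ∈ Finset.range m, p n k x * (g k w).re with hS
  set Q : ℕ → ℕ → Ω → ENNReal := fun n m w => ∫⁻ x, smallIndicator M (S n m w x) ∂μ with hQ
  have hg := fun k => (hlaw k).aemeasurable
  have hSm : ∀ n m, AEMeasurable (Function.uncurry (S n m)) (P.prod μ) := by
    intro n m
    refine Finset.aemeasurable_fun_sum _ fun k _ => ?_
    exact ((hp n k).comp measurable_snd).aemeasurable.mul
      (Complex.measurable_re.comp_aemeasurable (hg k).comp_fst)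
  have hIm : ∀ n m, AEMeasurable (Function.uncurry fun w x => smallIndicator M (S n m w x))
      (P.prod μ) := fun n m => (measurable_smallIndicator M).comp_aemeasurable (hSm n m)
  have hQm : ∀ n m, AEMeasurable (Q n m) P := fun n m => (hIm n m).lintegral_prod_right'
  have hEQ : ∀ n m, ∫⁻ w, Q n m w ∂P ≤
      ∫⁻ x, smallBallBound M (∑ k ∈ Finset.range m, p n k x ^ 2 / 2) ∂μ := by
    intro n m
    rw [hQ, lintegral_lintegral_swap (hIm n m)]
    refine lintegral_mono fun x => ?_
    rw [lintegral_smallIndicator]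
    · exact measure_abs_sum_re_lt_le hlaw hindep (fun k => p n k x) m hM
    · exact Finset.aemeasurable_fun_sum _ fun k _ =>
        (Complex.measurable_re.comp_aemeasurable (hg k)).const_mul _
  -- Fatou's lemma over the probability space, once in `n` and once in `m`, reduces this to the
  -- deterministic bound.
  have hQQ : ∫⁻ w, liminf (fun n => liminf (fun m => Q n m w) atTop) atTop ∂P = 0 := by
    refine le_antisymm ?_ zero_le
    rw [← liminf_liminf_lintegral_smallBallBound hp hlim hdiv hM]
    refine (lintegral_liminf_le' fun n => aemeasurable_liminf fun m => hQm n m).trans ?_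
    refine liminf_le_liminf (Eventually.of_forall fun n => ?_)
    refine (lintegral_liminf_le' fun m => hQm n m).trans ?_
    exact liminf_le_liminf (Eventually.of_forall fun m => hEQ n m)
  rw [lintegral_eq_zero_iff' (aemeasurable_liminf fun n =>
    aemeasurable_liminf fun m => hQm n m)] at hQQ
  -- The exceptional set involves only partial sums, so it is fixed before `F`. For such `w`, lower
  -- semicontinuity and Fatou in `x` pass from the partial sums to `F`.
  filter_upwards [hQQ] with w hw F hF
  refine le_antisymm ?_ zero_le
  refine le_trans (liminf_le_liminf (Eventually.of_forall fun n => ?_)) hw.le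
  have hSF : ∀ x, Tendsto (fun m => S n m w x) atTop (𝓝 (F n x)) := fun x =>
    (hF n x).tendsto_sum_nat
  have hSm' : ∀ m, Measurable (S n m w) := fun m => by
    simp only [hS]
    exact Finset.measurable_fun_sum _ fun k _ => (hp n k).mul_const _
  have hFm : Measurable (F n) := measurable_of_tendsto_metrizable hSm' (tendsto_pi_nhds.2 hSF)
  rw [← lintegral_smallIndicator hFm.aemeasurable]
  refine (lintegral_mono fun x => smallIndicator_le_liminf M (hSF x)).trans ?_
  exact lintegral_liminf_le fun m => (measurable_smallIndicator M).comp (hSm' m)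

end SmallBall

/-! ### Mollification of tempered distributions -/

section Mollifier

open Filter Topology Metric

/-- Bump functions on the plane shrinking to the origin. -/
def shrinkingBump (n : ℕ) : ContDiffBump (0 : Plane) where
  rIn := 1 / (2 * (n + 1))
  rOut := 1 / (n + 1)
  rIn_pos := by positivity
  rIn_lt_rOut := by
    have : (0 : ℝ) < n + 1 := by positivity
    apply one_div_lt_one_div_of_lt this
    linarith

theorem tendsto_rOut_shrinkingBump :
    Tendsto (fun n => (shrinkingBump n).rOut) atTop (𝓝 0) :=
  tendsto_one_div_add_atTop_nhds_zero_nat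

/-- The mollifier `ρ_n(x - y)` as a function of `y`. -/
def mollifierFun (n : ℕ) (x y : Plane) : ℝ := (shrinkingBump n).normed volume (x - y)

theorem contDiff_mollifierFun (n : ℕ) (x : Plane) :
    ContDiff ℝ ∞ fun y => (mollifierFun n x y : ℂ) :=
  Complex.ofRealCLM.contDiff.comp
    ((shrinkingBump n).contDiff_normed.comp (contDiff_const.sub contDiff_id))

theorem continuous_mollifierFun (n : ℕ) :
    Continuous fun z : Plane × Plane => mollifierFun n z.1 z.2 :=
  (shrinkingBump n).continuous_normed.comp (continuous_fst.sub continuous_snd)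

theorem support_mollifierFun (n : ℕ) (x : Plane) :
    Function.support (fun y => (mollifierFun n x y : ℂ)) = ball x (1 / (n + 1)) := by
  ext y
  have h : (shrinkingBump n).normed volume (x - y) ≠ 0 ↔ x - y ∈ ball 0 (1 / ((n : ℝ) + 1)) := by
    rw [← Function.mem_support, (shrinkingBump n).support_normed_eq]
    rfl
  rw [Function.mem_support, Complex.ofReal_ne_zero, mollifierFun, h, mem_ball_zero_iff, mem_ball,
    dist_comm, dist_eq_norm]

theorem tsupport_mollifierFun_subset (n : ℕ) (x : Plane) :
    tsupport (fun y => (mollifierFun n x y : ℂ)) ⊆ closedBall x (1 / (n + 1)) := by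
  rw [tsupport, support_mollifierFun]
  exact closure_ball_subset_closedBall

theorem hasCompactSupport_mollifierFun (n : ℕ) (x : Plane) :
    HasCompactSupport fun y => (mollifierFun n x y : ℂ) :=
  (isCompact_closedBall x _).of_isClosed_subset (isClosed_tsupport _)
    (tsupport_mollifierFun_subset n x)

/-- The mollifier as a Schwartz function. -/
def mollifier (n : ℕ) (x : Plane) : 𝓢(Plane, ℂ) :=
  (hasCompactSupport_mollifierFun n x).toSchwartzMap (contDiff_mollifierFun n x)

theorem mollifier_apply (n : ℕ) (x y : Plane) : mollifier n x y = (mollifierFun n x y : ℂ) := rfl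

theorem lintegral_mollifierFun (n : ℕ) (y : Plane) :
    ∫⁻ x, ENNReal.ofReal (mollifierFun n x y) = 1 := by
  have h := lintegral_sub_right_eq_self (μ := (volume : Measure Plane))
    (fun x => ENNReal.ofReal ((shrinkingBump n).normed volume x)) y
  refine h.trans ?_
  rw [← ofReal_integral_eq_lintegral_ofReal (shrinkingBump n).integrable_normed
    (ae_of_all _ (shrinkingBump n).nonneg_normed), (shrinkingBump n).integral_normed,
    ENNReal.ofReal_one]

theorem enorm_mollifierFun (n : ℕ) (x y : Plane) :
    ‖(mollifierFun n x y : ℂ)‖ₑ = ENNReal.ofReal (mollifierFun n x y) := by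
  rw [← ofReal_norm, Complex.norm_real, Real.norm_of_nonneg]
  exact (shrinkingBump n).nonneg_normed _

/-- The distribution `v` agrees on the open set `U` with the function `H`. -/
def AgreesOn (v : 𝓢'(Plane, ℂ)) (H : Plane → ℂ) (U : Set Plane) : Prop :=
  ∀ φ : 𝓢(Plane, ℂ), tsupport φ ⊆ U → HasCompactSupport φ → v φ = ∫ x, φ x * H x

/-- If the mollifications of `v` are large on most of a ball, along a subsequence, then `v` is not
an integrable function near that ball. -/
theorem not_agreesOn_of_liminf {v : 𝓢'(Plane, ℂ)} {q : Plane} {r : ℝ} (hr : 0 < r)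
    (hsmall : ∀ M : ℕ, liminf (fun n =>
      volume.restrict (ball q r) {x | |(v (mollifier n x)).re| < M}) atTop = 0)
    {H : Plane → ℂ} (hH : IntegrableOn H (ball q (2 * r))) :
    ¬ AgreesOn v H (ball q (2 * r)) := by
  intro hv
  set B := ball q r
  set B2 := ball q (2 * r)
  set μ : Measure Plane := volume.restrict B with hμ
  set A := ∫⁻ y in B2, ‖H y‖ₑ with hA
  have hAfin : A ≠ ⊤ := hH.2.ne
  have hμB : μ Set.univ = volume B := by simp [hμ]
  have hB0 : μ Set.univ ≠ 0 := by
    rw [hμB]; exact (measure_ball_pos volume q hr).ne'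
  have hBfin : μ Set.univ ≠ ⊤ := by
    rw [hμB]; exact measure_ball_lt_top.ne
  -- A majorant of the mollification: `|H|` on the larger ball convolved with a kernel of mass one,
  -- so its integral over `B` is at most `A`.
  set G : ℕ → Plane → ENNReal := fun n x =>
    ∫⁻ y in B2, ENNReal.ofReal (mollifierFun n x y) * ‖H y‖ₑ with hG
  have hjoint : ∀ n, AEMeasurable
      (Function.uncurry fun x y => ENNReal.ofReal (mollifierFun n x y) * ‖H y‖ₑ)
      (μ.prod (volume.restrict B2)) := by
    intro n
    refine AEMeasurable.mul ?_ hH.1.enorm.comp_snd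
    exact ENNReal.measurable_ofReal.comp_aemeasurable
      (continuous_mollifierFun n).measurable.aemeasurable
  have hGm : ∀ n, AEMeasurable (G n) μ := fun n => (hjoint n).lintegral_prod_right'
  have hGle : ∀ n, ∫⁻ x, G n x ∂μ ≤ A := by
    intro n
    rw [hG, lintegral_lintegral_swap (hjoint n)]
    refine lintegral_mono fun y => ?_
    rw [lintegral_mul_const _ (by
      exact ENNReal.measurable_ofReal.comp
        ((continuous_mollifierFun n).comp (Continuous.prodMk_left y)).measurable)]
    refine mul_le_of_le_one_left zero_le ?_
    rw [← lintegral_mollifierFun n y]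
    exact setLIntegral_le_lintegral _ _
  have hvG : ∀ n : ℕ, 1 / ((n : ℝ) + 1) < r → ∀ x ∈ B, ‖v (mollifier n x)‖ₑ ≤ G n x := by
    intro n hn x hx
    have hsub : tsupport (mollifier n x) ⊆ B2 := by
      refine (tsupport_mollifierFun_subset n x).trans fun y hy => ?_
      have h1 : dist x q < r := hx
      have h2 : dist y x ≤ 1 / (n + 1) := hy
      have h3 := dist_triangle y x q
      exact mem_ball.2 (by linarith)
    rw [hv _ hsub (hasCompactSupport_mollifierFun n x)]
    refine (enorm_integral_le_lintegral_enorm _).trans ?_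
    change _ ≤ ∫⁻ y in B2, ENNReal.ofReal (mollifierFun n x y) * ‖H y‖ₑ
    rw [← lintegral_indicator (show MeasurableSet B2 from measurableSet_ball)]
    refine lintegral_mono fun y => ?_
    rw [enorm_mul, mollifier_apply, enorm_mollifierFun]
    by_cases hy : y ∈ B2
    · rw [Set.indicator_of_mem hy]
    · have h0 : mollifier n x y = 0 := image_eq_zero_of_notMem_tsupport fun h => hy (hsub h)
      rw [mollifier_apply, Complex.ofReal_eq_zero] at h0
      rw [h0]
      simp
  -- By Markov, `G n ≥ M` on at most half of `B`. For a suitable `n` the mollification is below `M`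
  -- on less than half of `B`, yet the two sets cover `B` almost everywhere.
  obtain ⟨M, hM⟩ : ∃ M : ℕ, 2 * A / μ Set.univ < M :=
    ENNReal.exists_nat_gt (ENNReal.div_ne_top (ENNReal.mul_ne_top (by simp) hAfin) hB0)
  have hlt : liminf (fun n => μ {x | |(v (mollifier n x)).re| < M}) atTop < μ Set.univ / 2 := by
    rw [hsmall M]
    exact ENNReal.div_pos hB0 (by simp)
  have hev : ∀ᶠ n : ℕ in atTop, 1 / ((n : ℝ) + 1) < r :=
    (tendsto_order.1 tendsto_one_div_add_atTop_nhds_zero_nat).2 r hr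
  obtain ⟨n, hn, hnr⟩ := ((frequently_lt_of_liminf_lt (by isBoundedDefault) hlt).and_eventually
    hev).exists
  have hM0 : (M : ENNReal) ≠ 0 := by
    rintro h0; rw [h0] at hM; exact not_lt_zero hM
  have hlarge : μ {x | (M : ENNReal) ≤ G n x} ≤ μ Set.univ / 2 := by
    have h1 := (mul_meas_ge_le_lintegral₀ (hGm n) M).trans (hGle n)
    have h2 : 2 * A < M * μ Set.univ := (ENNReal.div_lt_iff (Or.inl hB0) (Or.inl hBfin)).1 hM
    rw [ENNReal.le_div_iff_mul_le (by simp) (by simp)]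
    have h3 : (M : ENNReal) * (μ {x | (M : ENNReal) ≤ G n x} * 2) ≤ M * μ Set.univ :=
      calc _ = 2 * (M * μ {x | (M : ENNReal) ≤ G n x}) := by ring
        _ ≤ 2 * A := by gcongr
        _ ≤ _ := h2.le
    exact (ENNReal.mul_le_mul_iff_right hM0 (ENNReal.natCast_ne_top M)).1 h3
  have hcover : μ Set.univ ≤ μ {x | |(v (mollifier n x)).re| < M} +
      μ {x | (M : ENNReal) ≤ G n x} := by
    refine le_trans ?_ (measure_union_le _ _)
    refine measure_mono_ae ?_
    filter_upwards [ae_restrict_mem measurableSet_ball] with x hx _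
    by_cases h : |(v (mollifier n x)).re| < M
    · exact Or.inl h
    · refine Or.inr (le_trans ?_ (hvG n hnr x hx))
      rw [← ofReal_norm, ← ENNReal.ofReal_natCast]
      exact ENNReal.ofReal_le_ofReal ((not_lt.1 h).trans (Complex.abs_re_le_norm _))
  have := hcover.trans_lt (ENNReal.add_lt_add_of_lt_of_le
    (hlarge.trans_lt (ENNReal.div_lt_top hBfin (by simp))).ne hn hlarge)
  rw [ENNReal.add_halves] at this
  exact lt_irrefl _ this

end Mollifier

/-! ### Mollified eigenfunctions -/

section Main

open Filter Topology Metric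

/-- The eigenfunction `e_k` as a real valued function. -/
def eigenfunReal (k : ℕ) (x : Plane) : ℝ := (1 / Real.sqrt Real.pi) * laguerreFun k (‖x‖ ^ 2)

theorem eigenfun_eq_ofReal (k : ℕ) (x : Plane) : eigenfun k x = (eigenfunReal k x : ℂ) := rfl

theorem continuous_eigenfunReal (k : ℕ) : Continuous (eigenfunReal k) :=
  Complex.continuous_re.comp (eigenfun k).continuous

/-- The mollified eigenfunction `ρ_n * e_k`. -/
def mollifiedEigenfun (n k : ℕ) : Plane → ℝ :=
  convolution ((shrinkingBump n).normed volume) (eigenfunReal k)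
    (ContinuousLinearMap.lsmul ℝ ℝ) volume

theorem continuous_mollifiedEigenfun (n k : ℕ) : Continuous (mollifiedEigenfun n k) :=
  (shrinkingBump n).hasCompactSupport_normed.continuous_convolution_left _
    (shrinkingBump n).continuous_normed (continuous_eigenfunReal k).locallyIntegrable

theorem tendsto_mollifiedEigenfun (k : ℕ) (x : Plane) :
    Tendsto (fun n => mollifiedEigenfun n k x) atTop (𝓝 (eigenfunReal k x)) :=
  ContDiffBump.convolution_tendsto_right_of_continuous tendsto_rOut_shrinkingBump
    (continuous_eigenfunReal k) x

theorem coe_eigenfun_mollifier (n k : ℕ) (x : Plane) :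
    (eigenfun k : 𝓢'(Plane, ℂ)) (mollifier n x) = (mollifiedEigenfun n k x : ℂ) := by
  rw [SchwartzMap.coe_apply, mollifiedEigenfun, convolution_lsmul_swap, ← integral_complex_ofReal]
  congr 1
  funext y
  rw [mollifier_apply, eigenfun_eq_ofReal, smul_eq_mul, smul_eq_mul, Complex.ofReal_mul]
  rfl

/-- The threshold enters here: `σ - 1 ≥ -1/2`, so the weights dominate `(4k+2)^{-1/2}`, for which
divergence is known when `|x|² > 0`. -/
theorem not_summable_weighted_eigenfunReal_sq {σ : ℝ} (hσ : 1 / 2 ≤ σ) {x : Plane} (hx : x ≠ 0) :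
    ¬ Summable fun k : ℕ => ((4 * k + 2 : ℝ) ^ ((σ - 1) / 2) * eigenfunReal k x) ^ 2 := by
  intro hs
  have hx2 : 0 < ‖x‖ ^ 2 := by positivity
  refine not_summable_laguerreFun_sq hx2 ?_
  refine Summable.of_nonneg_of_le (fun k => by positivity) (fun k => ?_) (hs.mul_left Real.pi)
  have hk : (0 : ℝ) < 4 * k + 2 := by positivity
  have hk1 : (1 : ℝ) ≤ 4 * k + 2 := by
    have : (0 : ℝ) ≤ k := by positivity
    linarith
  have h1 : ((4 * k + 2 : ℝ) ^ ((σ - 1) / 2)) ^ 2 = (4 * k + 2 : ℝ) ^ (σ - 1) := by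
    rw [← Real.rpow_natCast, ← Real.rpow_mul hk.le]
    congr 1
    push_cast
    ring
  have h2 : 1 / Real.sqrt (4 * k + 2) ≤ (4 * k + 2 : ℝ) ^ (σ - 1) := by
    rw [Real.sqrt_eq_rpow, one_div, ← Real.rpow_neg hk.le]
    exact Real.rpow_le_rpow_of_exponent_le hk1 (by linarith)
  have h3 : Real.pi * ((4 * k + 2 : ℝ) ^ ((σ - 1) / 2) * eigenfunReal k x) ^ 2 =
      (4 * k + 2 : ℝ) ^ (σ - 1) * laguerreFun k (‖x‖ ^ 2) ^ 2 := by
    rw [mul_pow, h1, eigenfunReal, mul_pow, div_pow, Real.sq_sqrt Real.pi_pos.le]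
    field_simp
  rw [h3]
  gcongr

/-! ### The random series -/

/-- The coefficients `(4k+2)^{(σ-1)/2} g_k` of `H^{σ/2} f`. -/
def hermiteCoeff (σ : ℝ) (z : ℕ → ℂ) (k : ℕ) : ℂ :=
  (((4 * k + 2 : ℝ) ^ ((σ - 1) / 2) : ℝ) : ℂ) * z k

theorem summable_hermiteCoeff (σ : ℝ) {z : ℕ → ℂ}
    (hz : Summable fun k : ℕ => ‖z k‖ * ((4 * k + 2 : ℝ) ^ 2)⁻¹) :
    Summable fun k => hermiteCoeff σ z k • (eigenfun k : 𝓢'(Plane, ℂ)) := by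
  -- The ceiling absorbs the weight `(4k+2)^{(σ-1)/2}`, also when the exponent is negative; the
  -- extra `2` is the decay assumed in `hz`.
  refine summable_smul_eigenfun (N := ⌈(σ - 1) / 2⌉₊ + 2) ?_
  refine Summable.of_nonneg_of_le (fun k => by positivity) (fun k => ?_) hz
  have hk : (0 : ℝ) < 4 * k + 2 := by positivity
  have hk1 : (1 : ℝ) ≤ 4 * k + 2 := by
    have : (0 : ℝ) ≤ k := by positivity
    linarith
  have h1 : (4 * k + 2 : ℝ) ^ ((σ - 1) / 2) ≤ (4 * k + 2 : ℝ) ^ ⌈(σ - 1) / 2⌉₊ := by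
    rw [← Real.rpow_natCast]
    exact Real.rpow_le_rpow_of_exponent_le hk1 (Nat.le_ceil _)
  rw [hermiteCoeff, norm_mul, Complex.norm_real, Real.norm_of_nonneg (by positivity), pow_add,
    mul_inv]
  calc _ ≤ (4 * k + 2 : ℝ) ^ ⌈(σ - 1) / 2⌉₊ * ‖z k‖ *
        (((4 * k + 2 : ℝ) ^ ⌈(σ - 1) / 2⌉₊)⁻¹ * ((4 * k + 2 : ℝ) ^ 2)⁻¹) := by gcongr
    _ = _ := by field_simp

theorem randomSeriesTerm_eq {Ω : Type*} (g : ℕ → Ω → ℂ) (w : Ω) :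
    randomSeriesTerm g w = fun k =>
      hermiteCoeff 0 (fun k => g k w) k • (eigenfun k : 𝓢'(Plane, ℂ)) := by
  funext k
  have h : 1 / Real.sqrt (4 * k + 2) = (4 * k + 2 : ℝ) ^ (((0 : ℝ) - 1) / 2) := by
    rw [Real.sqrt_eq_rpow, one_div, ← Real.rpow_neg (by positivity)]
    norm_num
  rw [randomSeriesTerm, hermiteCoeff, h]

theorem hermitePowTerm_randomSeries {Ω : Type*} {g : ℕ → Ω → ℂ} {w : Ω}
    (hz : Summable fun k : ℕ => ‖g k w‖ * ((4 * k + 2 : ℝ) ^ 2)⁻¹) (σ : ℝ) :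
    hermitePowTerm (σ / 2) (randomSeries g w) = fun k =>
      hermiteCoeff σ (fun k => g k w) k • (eigenfun k : 𝓢'(Plane, ℂ)) := by
  funext k
  rw [hermitePowTerm, randomSeries, randomSeriesTerm_eq,
    tsum_smul_eigenfun_apply_eigenfun (summable_hermiteCoeff 0 hz), hermiteCoeff, hermiteCoeff,
    ← mul_assoc, ← Complex.ofReal_mul, ← Real.rpow_add (by positivity)]
  congr 4
  ring

theorem hasSum_re_hermitePow_mollifier {σ : ℝ} {z : ℕ → ℂ}
    (hs : Summable fun k => hermiteCoeff σ z k • (eigenfun k : 𝓢'(Plane, ℂ))) (n : ℕ) (x : Plane) :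
    HasSum (fun k : ℕ => (4 * k + 2 : ℝ) ^ ((σ - 1) / 2) * mollifiedEigenfun n k x * (z k).re)
      ((∑' k, hermiteCoeff σ z k • (eigenfun k : 𝓢'(Plane, ℂ))) (mollifier n x)).re := by
  have h := Complex.hasSum_re (hasSum_apply hs (mollifier n x))
  convert h using 2 with k
  rw [distribution_smul_apply, coe_eigenfun_mollifier, hermiteCoeff,
    mul_assoc (Complex.ofReal _) (z k), mul_comm (z k), Complex.re_ofReal_mul,
    Complex.re_ofReal_mul, mul_assoc]

/-! ### Distributions given by functions near a ball -/

theorem contDiff_div_of_tsupport_subset {φ ψ : Plane → ℂ} (hφ : ContDiff ℝ ∞ φ)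
    (hψ : ContDiff ℝ ∞ ψ) (h : ∀ x ∈ tsupport φ, ψ x ≠ 0) : ContDiff ℝ ∞ fun x => φ x / ψ x := by
  rw [contDiff_iff_contDiffAt]
  intro x
  by_cases hx : x ∈ tsupport φ
  · simp only [div_eq_mul_inv]
    exact hφ.contDiffAt.mul (hψ.contDiffAt.inv (h x hx))
  · have h1 : φ =ᶠ[𝓝 x] 0 := notMem_tsupport_iff_eventuallyEq.1 hx
    refine (contDiffAt_const (c := (0 : ℂ))).congr_of_eventuallyEq ?_
    filter_upwards [h1] with y hy
    simp [hy]

/-- To evaluate `v` at `φ`, test `ψ v` against `φ/ψ`, which is smooth with compact support because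
`ψ` does not vanish on the support of `φ`. -/
theorem agreesOn_of_smulLeftCLM {v : 𝓢'(Plane, ℂ)} {ψ h : Plane → ℂ} (hψ : ContDiff ℝ ∞ ψ)
    (hψc : HasCompactSupport ψ) {U : Set Plane} (hU : ∀ x ∈ U, ψ x ≠ 0)
    (hv : ∀ φ : 𝓢(Plane, ℂ), TemperedDistribution.smulLeftCLM ℂ ψ v φ = ∫ x, φ x * h x) :
    AgreesOn v (fun x => h x * (ψ x)⁻¹) U := by
  intro φ hφU hφc
  have hsm : ContDiff ℝ ∞ fun x => φ x / ψ x :=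
    contDiff_div_of_tsupport_subset φ.smooth' hψ fun x hx => hU x (hφU hx)
  have hc : HasCompactSupport fun x => φ x / ψ x := by
    simp only [div_eq_mul_inv]
    exact hφc.mul_right
  have h1 := hv (hc.toSchwartzMap hsm)
  have h2 : SchwartzMap.smulLeftCLM ℂ ψ (hc.toSchwartzMap hsm) = φ := by
    ext x
    rw [SchwartzMap.smulLeftCLM_apply_apply (hψc.hasTemperateGrowth hψ)]
    change ψ x • (φ x / ψ x) = φ x
    by_cases hx : x ∈ tsupport φ
    · have := hU x (hφU hx)
      rw [smul_eq_mul]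
      field_simp
    · rw [image_eq_zero_of_notMem_tsupport hx]
      simp
  rw [TemperedDistribution.smulLeftCLM_apply_apply, h2] at h1
  rw [h1]
  congr 1
  funext x
  change φ x / ψ x * h x = _
  ring

/-- A countable family of balls forming a basis of the topology. -/
theorem exists_ball_denseSeq_subset {U : Set Plane} (hU : IsOpen U) {x : Plane} (hx : x ∈ U) :
    ∃ i j : ℕ, closedBall (TopologicalSpace.denseSeq Plane i) (2 * (1 / ((j : ℝ) + 1))) ⊆ U := by
  obtain ⟨ε, hε, hεU⟩ := isOpen_iff.1 hU x hx
  obtain ⟨j, hj⟩ := exists_nat_one_div_lt (show 0 < ε / 4 by positivity)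
  obtain ⟨i, hi⟩ := (TopologicalSpace.denseRange_denseSeq Plane).exists_dist_lt x
    (show 0 < ε / 4 by positivity)
  refine ⟨i, j, fun y hy => hεU ?_⟩
  have h1 : dist y (TopologicalSpace.denseSeq Plane i) ≤ 2 * (1 / ((j : ℝ) + 1)) := hy
  have h2 := dist_triangle_right y x (TopologicalSpace.denseSeq Plane i)
  exact mem_ball.2 (by linarith)

end Main

end

/-! ### The almost sure statement -/

theorem mainTheorem7 {Ω : Type*} [MeasurableSpace Ω] (P : Measure Ω) [IsProbabilityMeasure P]
    (g : ℕ → Ω → ℂ) (hlaw : ∀ k, HasLaw (g k) stdComplexGaussian P) (hindep : iIndepFun g P)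
    (σ : ℝ) (hσ : 1 / 2 ≤ σ) :
    ∀ᵐ w ∂P,
      Summable (randomSeriesTerm g w) ∧
      Summable (hermitePowTerm (σ / 2) (randomSeries g w)) ∧
      ¬ IsLocallyIntegrableDistribution (hermitePow (σ / 2) (randomSeries g w)) ∧
      ∀ ψ : Plane → ℂ, ContDiff ℝ ∞ ψ → HasCompactSupport ψ → (∃ x, ψ x ≠ 0) →
        ¬ IsL1Distribution
          (TemperedDistribution.smulLeftCLM ℂ ψ (hermitePow (σ / 2) (randomSeries g w))) := by
  have hsmall : ∀ i j M : ℕ, ∀ᵐ w ∂P, ∀ F : ℕ → Plane → ℝ,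
      (∀ n x, HasSum (fun k : ℕ => (4 * k + 2 : ℝ) ^ ((σ - 1) / 2) * mollifiedEigenfun n k x *
        (g k w).re) (F n x)) →
      Filter.liminf (fun n => volume.restrict
        (Metric.ball (TopologicalSpace.denseSeq Plane i) (1 / ((j : ℝ) + 1)))
          {x | |F n x| < (M : ℝ)}) Filter.atTop = 0 := by
    intro i j M
    have hfin : IsFiniteMeasure ((volume : Measure Plane).restrict
        (Metric.ball (TopologicalSpace.denseSeq Plane i) (1 / ((j : ℝ) + 1)))) :=
      isFiniteMeasure_restrict.2 measure_ball_lt_top.ne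
    refine ae_liminf_measure_abs_lt_eq_zero (q := fun k x =>
      (4 * k + 2 : ℝ) ^ ((σ - 1) / 2) * eigenfunReal k x) hlaw hindep
      (fun n k => (continuous_mollifiedEigenfun n k).measurable.const_mul _)
      (fun k x => (tendsto_mollifiedEigenfun k x).const_mul _) ?_ (by positivity)
    refine ae_restrict_of_ae ?_
    filter_upwards [Measure.ae_ne volume (0 : Plane)] with x hx
    exact not_summable_weighted_eigenfunReal_sq hσ hx
  -- Centres, radii and levels are countable, so a single null set is discarded before `ψ` is
  -- chosen.
  have hsmall' := ae_all_iff.2 fun i => ae_all_iff.2 fun j => ae_all_iff.2 fun M => hsmall i j M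
  filter_upwards [hsmall', ae_summable_norm_gaussian hlaw] with w hw hz
  have hs0 := summable_hermiteCoeff 0 hz
  have hs := summable_hermiteCoeff σ hz
  have hterm := hermitePowTerm_randomSeries hz σ
  have hnot : ∀ (i j : ℕ) (H : Plane → ℂ), IntegrableOn H (Metric.ball
      (TopologicalSpace.denseSeq Plane i) (2 * (1 / ((j : ℝ) + 1)))) →
      ¬ AgreesOn (hermitePow (σ / 2) (randomSeries g w)) H (Metric.ball
        (TopologicalSpace.denseSeq Plane i) (2 * (1 / ((j : ℝ) + 1)))) := by
    intro i j H hH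
    refine not_agreesOn_of_liminf (by positivity) (fun M => ?_) hH
    rw [hermitePow, hterm]
    exact hw i j M _ fun n x => hasSum_re_hermitePow_mollifier hs n x
  refine ⟨?_, ?_, ?_, ?_⟩
  · rw [randomSeriesTerm_eq]
    exact hs0
  · rw [hterm]
    exact hs
  · rintro ⟨h, hloc, hv⟩
    -- Any ball would do, since a locally integrable function is integrable on each of them.
    refine hnot 0 0 h ?_ fun φ _ hφ => hv φ hφ
    exact (hloc.integrableOn_isCompact (isCompact_closedBall _ _)).mono_set
      Metric.ball_subset_closedBall
  · rintro ψ hψ hψc ⟨x, hx⟩ ⟨h, hv⟩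
    obtain ⟨i, j, hij⟩ := exists_ball_denseSeq_subset
      (isOpen_ne_fun hψ.continuous continuous_const) hx
    refine hnot i j (fun x => h x * (ψ x)⁻¹) ?_ (agreesOn_of_smulLeftCLM hψ hψc
      (fun y hy => hij (Metric.ball_subset_closedBall hy)) fun φ => ?_)
    · have hint : Integrable h volume := memLp_one_iff_integrable.1 (Lp.memLp h)
      -- `ψ⁻¹` is continuous on the compact closed ball, where `ψ` has no zero, so `h/ψ` is
      -- integrable there.
      exact (hint.integrableOn.mul_continuousOn
        (hψ.continuous.continuousOn.inv₀ fun y hy => hij hy)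
        (isCompact_closedBall _ _)).mono_set Metric.ball_subset_closedBall
    · rw [← hv]
      exact MeasureTheory.Lp.toTemperedDistribution_apply h φ
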